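/- Let $n\ge 0$ be an integer. All $C^*$-algebras are unital, and $C^*(\dots\mid\dots)$ denotes the universal $C^*$-algebra with given generators and relations. A finitely generated Hopf algebra is a $C^*$-algebra $A$ together with a unitary matrix $u\in M_I(A)$ ($I$ a finite index set), whose coefficients generate $A$ as a $C^*$-algebra, such that there are morphisms of $C^*$-algebras $\Delta:A\to A\otimes A$, $\varepsilon:A\to\mathbb C$, $S:A\to A^{op}$ with $$\Delta(u_{ij})=\sum_k u_{ik}\otimes u_{kj},\qquad \varepsilon(u_{ij})=\delta_{ij},\qquad S(u_{ij})=u_{ji}^*$$ (these are then unique); $\otimes$ is the maximal $C^*$-tensor product. Let $A_o(n)=C^*(u_{ij},\ 1\le i,j\le n\mid u=\bar u,\ uu^t=u^tu=1)$ and let $C(O_n^{-1})$ be the quotient of $A_o(n)$ by the relations 1. $u_{ij}u_{ik}=-u_{ik}u_{ij}$ and $u_{ji}u_{ki}=-u_{ki}u_{ji}$ for all $i$ and all $j\ne k$; 2. $u_{ij}u_{kl}=u_{kl}u_{ij}$ for all $i\neq k$ and $j\neq l$. For a finite set $V$ let $A_s(V)=C^*(v_{xy},\ x,y\in V\mid v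 \text{ is a magic unitary})$, where a matrix is a magic unitary if all its entries are projections which, on each row and on each column, are pairwise orthogonal and sum up to $1$. For a finite graph $X$ with vertex set $V$ and adjacency matrix $d\in M_V(\{0,1\})$, the quantum symmetry algebra $A(X)$ is the quotient of $A_s(V)$ by the relations coming from $dv=vd$. Let $Q_n$ be the graph of the hypercube in $\mathbb R^n$: its vertices are the $2^n$ points of $\{-1,1\}^n$, two of them being joined by an edge if they differ in exactly one coordinate. Then $C(O_n^{-1})$ and $A(Q_n)$, with the matrices $u$ and $v$, are finitely generated Hopf algebras, and they are isomorphic as such: there is a $*$-isomorphism $\Phi:C(O_n^{-1})\to A(Q_n)$ with $$\Delta\Phi=(\Phi\otimes\Phi)\Delta,\qquad \varepsilon\Phi=\varepsilon,\qquad S\Phi=\Phi S.$$ -/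

import Mathlib

open scoped TensorProduct
open UniformSpace

noncomputable section

set_option linter.unusedSectionVars false

namespace QPerm

/-! ### C*-seminorms and their completions -/

/-- A C*-seminorm on a complex unital `*`-algebra. -/
structure CStarSeminorm (F : Type*) [Ring F] [StarRing F] [Algebra ℂ F] where
  toFun : F → ℝ
  add_le : ∀ a b, toFun (a + b) ≤ toFun a + toFun b
  smul_eq : ∀ (c : ℂ) (a : F), toFun (c • a) = ‖c‖ * toFun a
  mul_le : ∀ a b, toFun (a * b) ≤ toFun a * toFun b
  star_mul_self : ∀ a, toFun (star a * a) = toFun a * toFun a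

namespace CStarSeminorm

variable {F : Type*} [Ring F] [StarRing F] [Algebra ℂ F]

instance : CoeFun (CStarSeminorm F) (fun _ => F → ℝ) := ⟨toFun⟩

variable (p : CStarSeminorm F)

lemma map_zero : p 0 = 0 := by
  have := p.smul_eq 0 0
  simpa using this

lemma map_neg (a : F) : p (-a) = p a := by
  have := p.smul_eq (-1) a
  simpa using this

lemma nonneg (a : F) : 0 ≤ p a := by
  have h := p.add_le a (-a)
  rw [add_neg_cancel, p.map_zero, p.map_neg] at h
  linarith

lemma le_star (a : F) : p a ≤ p (star a) := by
  by_contra h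
  push Not at h
  have h1 := p.star_mul_self a
  have h2 := p.mul_le (star a) a
  have h3 := p.nonneg (star a)
  nlinarith

lemma map_star (a : F) : p (star a) = p a :=
  le_antisymm (by simpa using p.le_star (star a)) (p.le_star a)

lemma map_one_le : p 1 ≤ 1 := by
  have h := p.star_mul_self 1
  have h0 := p.nonneg 1
  simp only [star_one, one_mul] at h
  nlinarith

lemma eq_of_sub {a b : F} (h : p (a - b) = 0) : p a = p b := by
  have h1 := p.add_le (a - b) b
  have h2 := p.add_le (-(a - b)) a
  rw [p.map_neg] at h2
  simp only [sub_add_cancel, neg_sub] at h1 h2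
  linarith

/-- The algebra `F`, regarded as a seminormed algebra by means of `p`. -/
def Space (_p : CStarSeminorm F) : Type _ := F

instance : Ring p.Space := inferInstanceAs (Ring F)
instance : StarRing p.Space := inferInstanceAs (StarRing F)
instance : Algebra ℂ p.Space := inferInstanceAs (Algebra ℂ F)
instance [StarModule ℂ F] : StarModule ℂ p.Space := inferInstanceAs (StarModule ℂ F)

/-- The underlying ring seminorm. -/
def toRingSeminorm : RingSeminorm p.Space where
  toFun := p.toFun
  map_zero' := p.map_zero
  add_le' := p.add_le
  neg' := p.map_neg
  mul_le' := p.mul_le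

instance : SeminormedRing p.Space := RingSeminorm.toSeminormedRing p.toRingSeminorm

lemma norm_def (a : p.Space) : ‖a‖ = p.toFun a := rfl

instance : NormedAlgebra ℂ p.Space where
  norm_smul_le c a := (p.smul_eq c a).le

instance : NormedStarGroup p.Space where
  norm_star_le a := (p.map_star a).le

/-- The Hausdorff completion of `F` with respect to `p`, a C*-algebra. -/
def Compl : Type _ := Completion p.Space

instance : NormedRing p.Compl := inferInstanceAs (NormedRing (Completion p.Space))
instance : CompleteSpace p.Compl := inferInstanceAs (CompleteSpace (Completion p.Space))
instance : Algebra ℂ p.Compl := inferInstanceAs (Algebra ℂ (Completion p.Space))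

/-- The canonical map to the completion. -/
def coe (a : F) : p.Compl := Completion.coe' (α := p.Space) a

lemma coe_add (a b : F) : p.coe (a + b) = p.coe a + p.coe b :=
  Completion.coe_add (α := p.Space) a b
lemma coe_mul (a b : F) : p.coe (a * b) = p.coe a * p.coe b :=
  Completion.coe_mul (α := p.Space) a b
lemma coe_one : p.coe 1 = 1 := rfl
lemma coe_zero : p.coe 0 = 0 := rfl
lemma coe_smul (c : ℂ) (a : F) : p.coe (c • a) = c • p.coe a :=
  Completion.coe_smul (X := p.Space) c a
lemma norm_coe (a : F) : ‖p.coe a‖ = p a := Completion.norm_coe (E := p.Space) a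
lemma denseRange_coe : DenseRange p.coe := Completion.denseRange_coe (α := p.Space)

lemma induction {P : p.Compl → Prop} (x : p.Compl) (hP : IsClosed {x | P x})
    (h : ∀ a, P (p.coe a)) : P x :=
  Completion.induction_on (α := p.Space) x hP h

instance : NormedAlgebra ℂ p.Compl where
  norm_smul_le c x := by
    refine p.induction (P := fun x => ‖c • x‖ ≤ ‖c‖ * ‖x‖) x ?_ ?_
    · exact isClosed_le
        ((continuous_const_smul (T := Completion p.Space) c).norm)
        (continuous_const.mul continuous_norm)
    · intro a
      rw [← p.coe_smul, p.norm_coe, p.norm_coe, p.smul_eq]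

instance : Star p.Compl := ⟨Completion.map (α := p.Space) (β := p.Space) star⟩

lemma continuous_star_compl : Continuous (star : p.Compl → p.Compl) :=
  Completion.continuous_map (α := p.Space)

lemma coe_star (a : F) : p.coe (star a) = star (p.coe a) :=
  (Completion.map_coe (α := p.Space) (β := p.Space)
    (star_isometry (E := p.Space)).uniformContinuous a).symm

instance : StarRing p.Compl where
  star_involutive x := by
    refine p.induction (P := fun x => star (star x) = x) x ?_ ?_
    · exact isClosed_eq (p.continuous_star_compl.comp p.continuous_star_compl) continuous_id
    · intro a
      rw [← p.coe_star, ← p.coe_star, star_star]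
  star_mul x y := by
    have h := p.denseRange_coe.induction_on₂ (p := fun x y => star (x * y) = star y * star x)
      (isClosed_eq (p.continuous_star_compl.comp (continuous_fst.mul continuous_snd))
        ((p.continuous_star_compl.comp continuous_snd).mul
          (p.continuous_star_compl.comp continuous_fst)))
      (fun a b => by rw [← p.coe_mul, ← p.coe_star, star_mul, p.coe_mul, p.coe_star, p.coe_star])
    exact h x y
  star_add x y := by
    have h := p.denseRange_coe.induction_on₂ (p := fun x y => star (x + y) = star x + star y)
      (isClosed_eq (p.continuous_star_compl.comp (continuous_fst.add continuous_snd))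
        ((p.continuous_star_compl.comp continuous_fst).add
          (p.continuous_star_compl.comp continuous_snd)))
      (fun a b => by rw [← p.coe_add, ← p.coe_star, star_add, p.coe_add, p.coe_star, p.coe_star])
    exact h x y

instance : CStarRing p.Compl where
  norm_mul_self_le x := by
    refine p.induction (P := fun x => ‖x‖ * ‖x‖ ≤ ‖star x * x‖) x ?_ ?_
    · exact isClosed_le (continuous_norm.mul continuous_norm)
        (p.continuous_star_compl.mul continuous_id).norm
    · intro a
      rw [← p.coe_star, ← p.coe_mul, p.norm_coe, p.norm_coe, p.star_mul_self]

variable [StarModule ℂ F]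

instance : StarModule ℂ p.Compl where
  star_smul c x := by
    refine p.induction (P := fun x => star (c • x) = star c • star x) x ?_ ?_
    · exact isClosed_eq (p.continuous_star_compl.comp (continuous_const_smul c))
        ((continuous_const_smul (star c)).comp p.continuous_star_compl)
    · intro a
      rw [← p.coe_smul, ← p.coe_star, star_smul, p.coe_smul, p.coe_star]

instance : CStarAlgebra p.Compl where

/-- The canonical `*`-homomorphism from `F` to its completion. -/
def ι : F →⋆ₐ[ℂ] p.Compl where
  toFun := p.coe
  map_one' := p.coe_one
  map_mul' := p.coe_mul
  map_zero' := p.coe_zero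
  map_add' := p.coe_add
  commutes' c := by
    rw [Algebra.algebraMap_eq_smul_one, p.coe_smul, p.coe_one, ← Algebra.algebraMap_eq_smul_one]
  map_star' := p.coe_star

lemma norm_ι (a : F) : ‖p.ι a‖ = p a := p.norm_coe a

lemma uniformContinuous_of_le {B : Type*} [CStarAlgebra B] (φ : F →⋆ₐ[ℂ] B)
    (h : ∀ a, ‖φ a‖ ≤ p a) : UniformContinuous (fun a : p.Space => φ a) :=
  let g : p.Space →+ B := (φ : F →+ B)
  (AddMonoidHomClass.lipschitz_of_bound g 1
    (fun a => by rw [one_mul]; exact h a)).uniformContinuous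

/-- A `*`-homomorphism into a C*-algebra that is dominated by `p` extends to the completion. -/
def extend {B : Type*} [CStarAlgebra B] (φ : F →⋆ₐ[ℂ] B) (h : ∀ a, ‖φ a‖ ≤ p a) :
    p.Compl →⋆ₐ[ℂ] B :=
  have hu := p.uniformContinuous_of_le φ h
  let f : p.Compl → B := Completion.extension (α := p.Space) (fun a => φ a)
  have hc : Continuous f := Completion.continuous_extension
  have hf : ∀ a, f (p.coe a) = φ a := fun a => Completion.extension_coe hu a
  { toFun := f
    map_one' := by rw [← p.coe_one, hf, map_one]
    map_zero' := by rw [← p.coe_zero, hf, _root_.map_zero]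
    map_mul' := fun x y => p.denseRange_coe.induction_on₂
      (p := fun x y => f (x * y) = f x * f y)
      (isClosed_eq (hc.comp (continuous_fst.mul continuous_snd))
        ((hc.comp continuous_fst).mul (hc.comp continuous_snd)))
      (fun a b => by rw [← p.coe_mul, hf, hf, hf, map_mul]) x y
    map_add' := fun x y => p.denseRange_coe.induction_on₂
      (p := fun x y => f (x + y) = f x + f y)
      (isClosed_eq (hc.comp (continuous_fst.add continuous_snd))
        ((hc.comp continuous_fst).add (hc.comp continuous_snd)))
      (fun a b => by rw [← p.coe_add, hf, hf, hf, map_add]) x y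
    commutes' := fun c => by
      rw [Algebra.algebraMap_eq_smul_one, ← p.coe_one, ← p.coe_smul, hf, map_smul, map_one,
        ← Algebra.algebraMap_eq_smul_one]
    map_star' := fun x => p.induction (P := fun x => f (star x) = star (f x)) x
      (isClosed_eq (hc.comp p.continuous_star_compl) hc.star)
      (fun a => by rw [← p.coe_star, hf, hf, StarHomClass.map_star]) }

lemma extend_ι {B : Type*} [CStarAlgebra B] (φ : F →⋆ₐ[ℂ] B) (h : ∀ a, ‖φ a‖ ≤ p a) (a : F) :
    p.extend φ h (p.ι a) = φ a :=
  Completion.extension_coe (α := p.Space) (p.uniformContinuous_of_le φ h) a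

/-- The C*-seminorm `a ↦ ‖φ a‖` of a `*`-homomorphism into a C*-algebra. -/
def ofHom {B : Type*} [CStarAlgebra B] (φ : F →⋆ₐ[ℂ] B) : CStarSeminorm F where
  toFun a := ‖φ a‖
  add_le a b := by rw [map_add]; exact norm_add_le _ _
  smul_eq c a := by rw [map_smul, norm_smul]
  mul_le a b := by rw [map_mul]; exact norm_mul_le _ _
  star_mul_self a := by rw [map_mul, StarHomClass.map_star, CStarRing.norm_star_mul_self]

end CStarSeminorm

/-! ### The universal C*-algebra of a `*`-algebra with relations -/

section Univ

variable {F : Type*} [Ring F] [StarRing F] [Algebra ℂ F]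

/-- `p` respects the relations `a = b` for `R a b`. -/
def CStarSeminorm.Respects (p : CStarSeminorm F) (R : F → F → Prop) : Prop :=
  ∀ a b, R a b → p (a - b) = 0

/-- The relations `R` bound the C*-seminorms of every element, so that the universal C*-algebra
with these relations exists. -/
class Admissible (R : F → F → Prop) : Prop where
  bound : ∀ a : F, ∃ C : ℝ, ∀ p : CStarSeminorm F, p.Respects R → p a ≤ C

variable (R : F → F → Prop)

/-- The zero seminorm. -/
instance : Zero (CStarSeminorm F) where
  zero := ⟨fun _ => 0, by simp, by simp, by simp, by simp⟩

instance : Nonempty {p : CStarSeminorm F // p.Respects R} := ⟨⟨0, fun _ _ _ => rfl⟩⟩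

variable [Admissible R]

lemma bddAbove_seminorms (a : F) :
    BddAbove (Set.range fun p : {p : CStarSeminorm F // p.Respects R} => p.1 a) := by
  obtain ⟨C, hC⟩ := Admissible.bound (R := R) a
  exact ⟨C, by rintro _ ⟨p, rfl⟩; exact hC p.1 p.2⟩

/-- The largest C*-seminorm that respects the relations `R`. -/
def maxSeminorm : CStarSeminorm F where
  toFun a := ⨆ p : {p : CStarSeminorm F // p.Respects R}, p.1 a
  add_le a b := ciSup_le fun p => (p.1.add_le a b).trans
    (add_le_add (le_ciSup (bddAbove_seminorms R a) p) (le_ciSup (bddAbove_seminorms R b) p))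
  smul_eq c a := by
    rw [Real.mul_iSup_of_nonneg (norm_nonneg c)]
    exact congrArg iSup (funext fun p => p.1.smul_eq c a)
  mul_le a b := ciSup_le fun p => (p.1.mul_le a b).trans
    (mul_le_mul (le_ciSup (bddAbove_seminorms R a) p) (le_ciSup (bddAbove_seminorms R b) p)
      (p.1.nonneg b) ((p.1.nonneg a).trans (le_ciSup (bddAbove_seminorms R a) p)))
  star_mul_self a := by
    have h0 : 0 ≤ ⨆ p : {p : CStarSeminorm F // p.Respects R}, p.1 a :=
      Real.iSup_nonneg fun p => p.1.nonneg a
    apply le_antisymm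
    · refine ciSup_le fun p => ?_
      rw [p.1.star_mul_self]
      exact mul_le_mul (le_ciSup (bddAbove_seminorms R a) p) (le_ciSup (bddAbove_seminorms R a) p)
        (p.1.nonneg a) h0
    · rw [Real.mul_iSup_of_nonneg h0]
      refine ciSup_le fun p => ?_
      rw [Real.iSup_mul_of_nonneg (p.1.nonneg a)]
      refine ciSup_le fun q => ?_
      rcases le_total (p.1 a) (q.1 a) with h | h
      · refine le_trans ?_ (le_ciSup (bddAbove_seminorms R (star a * a)) q)
        rw [q.1.star_mul_self]
        exact mul_le_mul_of_nonneg_left h (q.1.nonneg a)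
      · refine le_trans ?_ (le_ciSup (bddAbove_seminorms R (star a * a)) p)
        rw [p.1.star_mul_self]
        exact mul_le_mul_of_nonneg_right h (p.1.nonneg a)

lemma maxSeminorm_respects : (maxSeminorm R).Respects R := fun a b h => by
  have : ∀ p : {p : CStarSeminorm F // p.Respects R}, p.1 (a - b) = 0 := fun p => p.2 a b h
  change (⨆ p : {p : CStarSeminorm F // p.Respects R}, p.1 (a - b)) = 0
  simp [this]

variable [StarModule ℂ F]

/-- The universal C*-algebra `C*(F | R)`: the completion of the `*`-algebra `F` with respect to the
largest C*-seminorm that respects `R`. If `F` is itself a C*-algebra, this is the quotient of `F`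
by the closed two-sided ideal generated by the elements `a - b` with `R a b`. -/
abbrev UnivCStar : Type _ := (maxSeminorm R).Compl

/-- The canonical `*`-homomorphism from `F` to `C*(F | R)`. -/
abbrev UnivCStar.mk : F →⋆ₐ[ℂ] UnivCStar R := (maxSeminorm R).ι

lemma UnivCStar.mk_eq {a b : F} (h : R a b) : UnivCStar.mk R a = UnivCStar.mk R b := by
  rw [← sub_eq_zero, ← map_sub, ← norm_eq_zero, CStarSeminorm.norm_ι]
  exact maxSeminorm_respects R a b h

lemma UnivCStar.norm_le {B : Type*} [CStarAlgebra B] (φ : F →⋆ₐ[ℂ] B)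
    (h : ∀ a b, R a b → φ a = φ b) (a : F) : ‖φ a‖ ≤ maxSeminorm R a :=
  le_ciSup (bddAbove_seminorms R a)
    ⟨CStarSeminorm.ofHom φ, fun a b hab => by
      change ‖φ (a - b)‖ = 0
      rw [map_sub, h a b hab, sub_self, norm_zero]⟩

/-- The universal property: a `*`-homomorphism from `F` to a C*-algebra that respects the relations
factors through `C*(F | R)`. -/
def UnivCStar.lift {B : Type*} [CStarAlgebra B] (φ : F →⋆ₐ[ℂ] B)
    (h : ∀ a b, R a b → φ a = φ b) : UnivCStar R →⋆ₐ[ℂ] B :=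
  (maxSeminorm R).extend φ (UnivCStar.norm_le R φ h)

lemma UnivCStar.lift_mk {B : Type*} [CStarAlgebra B] (φ : F →⋆ₐ[ℂ] B)
    (h : ∀ a b, R a b → φ a = φ b) (a : F) :
    UnivCStar.lift R φ h (UnivCStar.mk R a) = φ a :=
  CStarSeminorm.extend_ι _ _ _ a

end Univ

/-- On a C*-algebra every set of relations is admissible. -/
instance {A : Type*} [CStarAlgebra A] (R : A → A → Prop) : Admissible R where
  bound a := ⟨‖a‖, fun p _ => by
    rw [← p.norm_ι a]
    exact NonUnitalStarAlgHom.norm_apply_le p.ι a⟩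

/-! ### The tensor product of C*-algebras -/

section Tensor

variable (A B : Type*) [CStarAlgebra A] [CStarAlgebra B]

/-- No relations at all. -/
def NoRel (F : Type*) : F → F → Prop := fun _ _ => False

/-- The `*`-homomorphism `a ↦ a ⊗ 1` to the algebraic tensor product. -/
def inclLeft : A →⋆ₐ[ℂ] A ⊗[ℂ] B where
  __ := (Algebra.TensorProduct.includeLeft : A →ₐ[ℂ] A ⊗[ℂ] B)
  map_star' a := by simp

/-- The `*`-homomorphism `b ↦ 1 ⊗ b` to the algebraic tensor product. -/
def inclRight : B →⋆ₐ[ℂ] A ⊗[ℂ] B where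
  __ := (Algebra.TensorProduct.includeRight : B →ₐ[ℂ] A ⊗[ℂ] B)
  map_star' a := by simp

instance : Admissible (NoRel (A ⊗[ℂ] B)) where
  bound x := by
    induction x using TensorProduct.induction_on with
    | zero => exact ⟨0, fun p _ => p.map_zero.le⟩
    | add x y hx hy =>
      obtain ⟨C, hC⟩ := hx
      obtain ⟨D, hD⟩ := hy
      exact ⟨C + D, fun p hp => (p.add_le x y).trans (add_le_add (hC p hp) (hD p hp))⟩
    | tmul a b =>
      refine ⟨‖a‖ * ‖b‖, fun p _ => ?_⟩
      have h : a ⊗ₜ[ℂ] b = inclLeft A B a * inclRight A B b := by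
        change a ⊗ₜ[ℂ] b = (a ⊗ₜ[ℂ] (1 : B)) * ((1 : A) ⊗ₜ[ℂ] b)
        simp
      have h1 : p (inclLeft A B a) ≤ ‖a‖ := by
        rw [← p.norm_ι]
        exact NonUnitalStarAlgHom.norm_apply_le (p.ι.comp (inclLeft A B)) a
      have h2 : p (inclRight A B b) ≤ ‖b‖ := by
        rw [← p.norm_ι]
        exact NonUnitalStarAlgHom.norm_apply_le (p.ι.comp (inclRight A B)) b
      rw [h]
      exact (p.mul_le _ _).trans (mul_le_mul h1 h2 (p.nonneg _) (norm_nonneg a))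

/-- The C*-algebraic tensor product `A ⊗ B`: the completion of the algebraic tensor product with
respect to its largest C*-norm. Every other C*-tensor product is a quotient of this one, so
morphisms into it, and identities in it, are the strongest possible. -/
abbrev CTensor : Type _ := UnivCStar (NoRel (A ⊗[ℂ] B))

variable {A B}

/-- The elementary tensor `a ⊗ b` in the C*-algebraic tensor product. -/
def ctmul (a : A) (b : B) : CTensor A B := UnivCStar.mk (NoRel (A ⊗[ℂ] B)) (a ⊗ₜ[ℂ] b)

variable {A' B' : Type*} [CStarAlgebra A'] [CStarAlgebra B']

/-- The algebraic tensor product of two `*`-homomorphisms. -/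
def algTensorMap (f : A →⋆ₐ[ℂ] A') (g : B →⋆ₐ[ℂ] B') : A ⊗[ℂ] B →⋆ₐ[ℂ] A' ⊗[ℂ] B' where
  __ := Algebra.TensorProduct.map (f : A →ₐ[ℂ] A') (g : B →ₐ[ℂ] B')
  map_star' x := by
    induction x using TensorProduct.induction_on with
    | zero => simp
    | add x y hx hy => simp_all
    | tmul a b => simp [StarHomClass.map_star]

/-- The `*`-homomorphism `f ⊗ g` between C*-algebraic tensor products. -/
def CTensor.map (f : A →⋆ₐ[ℂ] A') (g : B →⋆ₐ[ℂ] B') : CTensor A B →⋆ₐ[ℂ] CTensor A' B' :=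
  UnivCStar.lift (NoRel (A ⊗[ℂ] B))
    ((UnivCStar.mk (NoRel (A' ⊗[ℂ] B'))).comp (algTensorMap f g)) (fun _ _ h => h.elim)

lemma CTensor.map_ctmul (f : A →⋆ₐ[ℂ] A') (g : B →⋆ₐ[ℂ] B') (a : A) (b : B) :
    CTensor.map f g (ctmul a b) = ctmul (f a) (g b) :=
  UnivCStar.lift_mk _ _ _ _

end Tensor

/-! ### Finitely generated Hopf algebras -/

/-- A finitely generated Hopf algebra: a C*-algebra `A` with a unitary matrix `u` whose
coefficients generate `A`, such that the three usual formulae define a comultiplication, a counit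
and an antipode. The three morphisms are determined by `u`. -/
structure FGHopf {I : Type*} [Fintype I] [DecidableEq I] (A : Type*) [CStarAlgebra A]
    (u : Matrix I I A) where
  unitary_mem : u ∈ unitary (Matrix I I A)
  dense : (StarAlgebra.adjoin ℂ {a : A | ∃ i j, a = u i j}).topologicalClosure = ⊤
  comul : A →⋆ₐ[ℂ] CTensor A A
  counit : A →⋆ₐ[ℂ] ℂ
  antipode : A →⋆ₐ[ℂ] Aᵐᵒᵖ
  comul_apply : ∀ i j, comul (u i j) = ∑ k, ctmul (u i k) (u k j)
  counit_apply : ∀ i j, counit (u i j) = if i = j then 1 else 0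
  antipode_apply : ∀ i j, antipode (u i j) = MulOpposite.op (star (u j i))

/-- An isomorphism of finitely generated Hopf algebras: a `*`-isomorphism that commutes with the
comultiplications, the counits and the antipodes. -/
structure IsHopfIso {I J : Type*} [Fintype I] [DecidableEq I] [Fintype J] [DecidableEq J]
    {A B : Type*} [CStarAlgebra A] [CStarAlgebra B] {u : Matrix I I A} {v : Matrix J J B}
    (H : FGHopf A u) (K : FGHopf B v) (Φ : A ≃⋆ₐ[ℂ] B) : Prop where
  comul : ∀ a, K.comul (Φ a) = CTensor.map (Φ : A →⋆ₐ[ℂ] B) (Φ : A →⋆ₐ[ℂ] B) (H.comul a)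
  counit : ∀ a, K.counit (Φ a) = H.counit a
  antipode : ∀ a, K.antipode (Φ a) = MulOpposite.op (Φ (H.antipode a).unop)

/-! ### Free `*`-algebras -/

/-- The free complex unital `*`-algebra on `X`, that is the free algebra on two copies of `X`, the
second one consisting of the adjoints of the first one. -/
def FreeStar (X : Type*) : Type _ := FreeAlgebra ℂ (X ⊕ X)

namespace FreeStar

variable {X : Type*}

instance : Ring (FreeStar X) := inferInstanceAs (Ring (FreeAlgebra ℂ (X ⊕ X)))
instance : Algebra ℂ (FreeStar X) := inferInstanceAs (Algebra ℂ (FreeAlgebra ℂ (X ⊕ X)))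

/-- The generators and their adjoints. -/
def ofSum (x : X ⊕ X) : FreeStar X := FreeAlgebra.ι ℂ x

/-- The generator attached to `x`. -/
def of (x : X) : FreeStar X := ofSum (Sum.inl x)

lemma induct {P : FreeStar X → Prop} (hs : ∀ c : ℂ, P (algebraMap ℂ _ c)) (ho : ∀ x, P (ofSum x))
    (hm : ∀ a b, P a → P b → P (a * b)) (ha : ∀ a b, P a → P b → P (a + b)) (a : FreeStar X) :
    P a :=
  FreeAlgebra.induction ℂ (X ⊕ X) (motive := P) hs ho hm ha a

/-- The opposite algebra, with conjugate scalars. -/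
abbrev conjAlgebra : Algebra ℂ (FreeStar X)ᵐᵒᵖ :=
  ((algebraMap ℂ (FreeStar X)ᵐᵒᵖ).comp (starRingEnd ℂ)).toAlgebra'
    fun c x => Algebra.commutes (starRingEnd ℂ c) x

/-- The antilinear antimultiplicative map that exchanges the generators with their adjoints. -/
def starHom : FreeStar X →+* (FreeStar X)ᵐᵒᵖ :=
  letI : Algebra ℂ (FreeStar X)ᵐᵒᵖ := conjAlgebra
  (FreeAlgebra.lift ℂ fun x : X ⊕ X => MulOpposite.op (ofSum x.swap)).toRingHom

lemma starHom_ofSum (x : X ⊕ X) : starHom (ofSum x) = MulOpposite.op (ofSum x.swap) :=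
  letI : Algebra ℂ (FreeStar X)ᵐᵒᵖ := conjAlgebra
  FreeAlgebra.lift_ι_apply (R := ℂ) (fun x : X ⊕ X => MulOpposite.op (ofSum x.swap)) x

lemma starHom_algebraMap (c : ℂ) :
    starHom (algebraMap ℂ (FreeStar X) c) =
      MulOpposite.op (algebraMap ℂ (FreeStar X) (star c)) :=
  letI : Algebra ℂ (FreeStar X)ᵐᵒᵖ := conjAlgebra
  (FreeAlgebra.lift ℂ fun x : X ⊕ X => MulOpposite.op (ofSum x.swap)).commutes c

instance : Star (FreeStar X) := ⟨fun a => (starHom a).unop⟩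

lemma star_def (a : FreeStar X) : star a = (starHom a).unop := rfl

lemma star_ofSum (x : X ⊕ X) : star (ofSum x) = ofSum x.swap := by
  rw [star_def, starHom_ofSum, MulOpposite.unop_op]

lemma star_algebraMap (c : ℂ) :
    star (algebraMap ℂ (FreeStar X) c) = algebraMap ℂ (FreeStar X) (star c) := by
  rw [star_def, starHom_algebraMap, MulOpposite.unop_op]

lemma star_mul_aux (a b : FreeStar X) : star (a * b) = star b * star a := by
  simp only [star_def, map_mul, MulOpposite.unop_mul]

lemma star_add_aux (a b : FreeStar X) : star (a + b) = star a + star b := by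
  simp only [star_def, map_add, MulOpposite.unop_add]

instance : StarRing (FreeStar X) where
  star_involutive a := by
    induction a using induct with
    | hs c => rw [star_algebraMap, star_algebraMap, star_star]
    | ho x => rw [star_ofSum, star_ofSum, Sum.swap_swap]
    | hm a b ha hb => rw [star_mul_aux, star_mul_aux, ha, hb]
    | ha a b ha hb => rw [star_add_aux, star_add_aux, ha, hb]
  star_mul := star_mul_aux
  star_add := star_add_aux

instance : StarModule ℂ (FreeStar X) where
  star_smul c a := by
    rw [Algebra.smul_def, star_mul, star_algebraMap, ← Algebra.commutes, ← Algebra.smul_def]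

/-- Relations that bound the generators are admissible. -/
lemma admissible {R : FreeStar X → FreeStar X → Prop}
    (h : ∀ x, ∃ C : ℝ, ∀ p : CStarSeminorm (FreeStar X), p.Respects R → p (of x) ≤ C) :
    Admissible R where
  bound a := by
    induction a using induct with
    | hs c =>
      refine ⟨‖c‖, fun p _ => ?_⟩
      rw [Algebra.algebraMap_eq_smul_one, p.smul_eq]
      exact mul_le_of_le_one_right (norm_nonneg c) p.map_one_le
    | ho x =>
      rcases x with x | x
      · exact h x
      · obtain ⟨C, hC⟩ := h x
        refine ⟨C, fun p hp => ?_⟩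
        have h1 : ofSum (Sum.inr x) = star (of x) := (star_ofSum (Sum.inl x)).symm
        rw [h1, p.map_star]
        exact hC p hp
    | hm a b ha hb =>
      obtain ⟨C, hC⟩ := ha
      obtain ⟨D, hD⟩ := hb
      exact ⟨C * D, fun p hp => (p.mul_le a b).trans (mul_le_mul (hC p hp) (hD p hp) (p.nonneg b)
        ((p.nonneg a).trans (hC p hp)))⟩
    | ha a b ha hb =>
      obtain ⟨C, hC⟩ := ha
      obtain ⟨D, hD⟩ := hb
      exact ⟨C + D, fun p hp => (p.add_le a b).trans (add_le_add (hC p hp) (hD p hp))⟩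

end FreeStar

/-! ### The algebras `A_o(n)` and `A_s(n)` -/

section Free

variable (I : Type*) [Fintype I] [DecidableEq I]

/-- The matrix of free variables `u i j`. -/
def freeMatrix : Matrix I I (FreeStar (I × I)) := Matrix.of fun i j => FreeStar.of (i, j)

/-- The relations of an orthogonal matrix: `ū = u`, `u uᵗ = 1` and `uᵗ u = 1`. -/
inductive OrthRel : FreeStar (I × I) → FreeStar (I × I) → Prop
  | real (i j : I) : OrthRel (star (freeMatrix I i j)) (freeMatrix I i j)
  | mul_transpose (i j : I) : OrthRel ((freeMatrix I * (freeMatrix I).transpose) i j)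
      ((1 : Matrix I I (FreeStar (I × I))) i j)
  | transpose_mul (i j : I) : OrthRel (((freeMatrix I).transpose * freeMatrix I) i j)
      ((1 : Matrix I I (FreeStar (I × I))) i j)

/-- The relations of a magic unitary matrix: all entries are projections, and on each row and
column these are mutually orthogonal and sum up to `1`. -/
inductive MagicRel : FreeStar (I × I) → FreeStar (I × I) → Prop
  | selfAdjoint (i j : I) : MagicRel (star (freeMatrix I i j)) (freeMatrix I i j)
  | idempotent (i j : I) : MagicRel (freeMatrix I i j * freeMatrix I i j) (freeMatrix I i j)
  | row_orth (i j k : I) (h : j ≠ k) : MagicRel (freeMatrix I i j * freeMatrix I i k) 0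
  | col_orth (i j k : I) (h : j ≠ k) : MagicRel (freeMatrix I j i * freeMatrix I k i) 0
  | row_sum (i : I) : MagicRel (∑ j, freeMatrix I i j) 1
  | col_sum (i : I) : MagicRel (∑ j, freeMatrix I j i) 1

lemma norm_le_one_of_sum_sq {C : Type*} [CStarAlgebra C] (a : I → C)
    (h : ∀ k, star (a k) = a k) (hs : ∑ k, a k * a k = 1) (j : I) : ‖a j‖ ≤ 1 := by
  let _ : PartialOrder C := CStarAlgebra.spectralOrder C
  have _ : StarOrderedRing C := CStarAlgebra.spectralOrderedRing C
  have hn : ∀ k, 0 ≤ a k * a k := fun k => by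
    have := star_mul_self_nonneg (a k)
    rwa [h k] at this
  have h1 : a j * a j ≤ 1 := by
    rw [← hs]
    exact Finset.single_le_sum (f := fun k => a k * a k) (fun k _ => hn k) (Finset.mem_univ j)
  have h2 : ‖a j * a j‖ ≤ 1 := (CStarAlgebra.norm_le_one_iff_of_nonneg _ (hn j)).2 h1
  have h3 : ‖a j * a j‖ = ‖a j‖ * ‖a j‖ := by
    have := CStarRing.norm_star_mul_self (x := a j)
    rwa [h j] at this
  have := norm_nonneg (a j)
  nlinarith

instance : Admissible (OrthRel I) := FreeStar.admissible fun x =>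
  ⟨1, fun p hp => by
    have e : ∀ a b, OrthRel I a b → p.ι a = p.ι b := fun a b hab => by
      rw [← sub_eq_zero, ← map_sub, ← norm_eq_zero, p.norm_ι]
      exact hp a b hab
    rw [← p.norm_ι]
    refine norm_le_one_of_sum_sq I (fun k => p.ι (freeMatrix I x.1 k)) (fun k => ?_) ?_ x.2
    · rw [← StarHomClass.map_star]
      exact e _ _ (OrthRel.real _ _)
    · have := e _ _ (OrthRel.mul_transpose x.1 x.1)
      simpa [Matrix.mul_apply] using this⟩

instance : Admissible (MagicRel I) := FreeStar.admissible fun x =>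
  ⟨1, fun p hp => by
    have h1 : p (star (FreeStar.of x) * FreeStar.of x) = p (FreeStar.of x) := by
      have e1 := hp _ _ (MagicRel.selfAdjoint x.1 x.2)
      have e2 : p (FreeStar.of x * FreeStar.of x) = p (FreeStar.of x) :=
        p.eq_of_sub (hp _ _ (MagicRel.idempotent x.1 x.2))
      rw [← e2]
      refine p.eq_of_sub (le_antisymm ?_ (p.nonneg _))
      have := p.mul_le (star (FreeStar.of x) - FreeStar.of x) (FreeStar.of x)
      have e1' : p (star (FreeStar.of x) - FreeStar.of x) = 0 := e1
      rw [e1', zero_mul, sub_mul] at this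
      exact this
    rw [p.star_mul_self] at h1
    have := p.nonneg (FreeStar.of x)
    nlinarith⟩

/-- `A_o(n)`, the universal C*-algebra generated by the entries of an orthogonal matrix. -/
abbrev Ao : Type _ := UnivCStar (OrthRel I)

/-- The fundamental orthogonal matrix of `A_o(n)`. -/
def Ao.u : Matrix I I (Ao I) := (freeMatrix I).map (UnivCStar.mk (OrthRel I))

/-- `A_s(n)`, the universal C*-algebra generated by the entries of a magic unitary matrix. -/
abbrev As : Type _ := UnivCStar (MagicRel I)

/-- The fundamental magic unitary matrix of `A_s(n)`. -/
def As.u : Matrix I I (As I) := (freeMatrix I).map (UnivCStar.mk (MagicRel I))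

/-! ### The algebra `C(O_n^{-1})` -/

/-- The skew-commutation relations for `GL_n^{-1}`: distinct entries on the same row or on the same
column anticommute, and entries on different rows and different columns commute. -/
inductive SkewRel : Ao I → Ao I → Prop
  | row (i j k : I) (h : j ≠ k) : SkewRel (Ao.u I i j * Ao.u I i k) (-(Ao.u I i k * Ao.u I i j))
  | col (i j k : I) (h : j ≠ k) : SkewRel (Ao.u I j i * Ao.u I k i) (-(Ao.u I k i * Ao.u I j i))
  | comm (i j k l : I) (hik : i ≠ k) (hjl : j ≠ l) :
      SkewRel (Ao.u I i j * Ao.u I k l) (Ao.u I k l * Ao.u I i j)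

/-- `C(O_n^{-1})`, the quotient of `A_o(n)` by the skew-commutation relations. -/
abbrev COneg : Type _ := UnivCStar (SkewRel I)

/-- The fundamental matrix of `C(O_n^{-1})`. -/
def COneg.u : Matrix I I (COneg I) := (Ao.u I).map (UnivCStar.mk (SkewRel I))

end Free

/-! ### Quantum symmetry algebras of graphs -/

section Graph

variable {V : Type*} [Fintype V] [DecidableEq V] (G : SimpleGraph V) [DecidableRel G.Adj]

/-- The relations coming from `d u = u d`, where `d` is the adjacency matrix of the graph and `u`
is the fundamental magic unitary matrix. -/
inductive GraphRel : As V → As V → Prop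
  | comm (i j : V) : GraphRel ((G.adjMatrix (As V) * As.u V) i j) ((As.u V * G.adjMatrix (As V)) i j)

/-- The quantum symmetry algebra of a finite graph, the quotient of `A_s(n)` by `d u = u d`. -/
abbrev QSym : Type _ := UnivCStar (GraphRel G)

/-- The fundamental magic unitary matrix of the quantum symmetry algebra of a graph. -/
def QSym.u : Matrix V V (QSym G) := (As.u V).map (UnivCStar.mk (GraphRel G))

end Graph

/-- The graph of the hypercube in `ℝⁿ`: the vertices are the `2 ^ n` points with all coordinates in
`{-1, 1}` (encoded by signs), joined by an edge if they differ in exactly one coordinate. -/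
def hypercube (n : ℕ) : SimpleGraph (Fin n → ℤˣ) where
  Adj x y := hammingDist x y = 1
  symm := ⟨fun x y h => by rw [hammingDist_comm]; exact h⟩
  loopless := ⟨fun x h => by simp at h⟩

instance (n : ℕ) : DecidableRel (hypercube n).Adj := fun x y =>
  inferInstanceAs (Decidable (hammingDist x y = 1))

end QPerm

end

noncomputable section

set_option linter.unusedSectionVars false

namespace QPerm

/-! ### Morphisms out of universal C*-algebras -/

section Morphisms

variable {B : Type*} [CStarAlgebra B]

/-! Both algebras are universal, so it is enough to convert a matrix satisfying one set of relations
into a matrix satisfying the other, naturally in the ambient algebra, and to see that the two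
conversions are mutually inverse. The link between them is the family s_j(x) = ∑_i x_i u_ij
(`colSum`), for x a vertex of the cube.

If u is skew orthogonal, then for fixed x the s_j(x) are commuting self-adjoint elements of square
1. Let v_xy be their joint spectral projection ∏_j (1 + y_j s_j(x))/2 for the sign pattern y
(`cubeMatrix`). The rows of v are then partitions of unity. An induction on the number of factors
(`sum_projProd_flip`) gives dv = vd. Hence the column sums of v are harmonic functions on the cube,
therefore constant and equal to 1, and projections summing up to 1 are orthogonal.

Conversely, if dv = vd then v preserves the eigenspaces of d. The one for the eigenvalue n - 2 is
spanned by the coordinate functions, and u is the matrix of v on it (`linPart`), so that s_j(x) =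
∑_y y_j v_xy (`rowSum_eq_colSum`). As the rows of v are magic, f ↦ ∑_y f(y) v_xy is multiplicative,
so the s_j(x) commute and have square 1 for every x. Second differences in x extract relations
between the entries of u; with those of the transpose of v they are the skew relations
(`IsMagic.isSkewOrth_linPart`).

The formula s_j(x) = ∑_y y_j v_xy is at once the spectral decomposition of s_j(x) and the action of
v on a coordinate function, which makes the constructions inverse to each other. Restriction to an
invariant subspace respects products, identity and transposition, hence the Hopf structure
(`linPart_mul`, `linPart_one`, `linPart_opMatrix`). -/

lemma continuous_starAlgHom {A : Type*} [CStarAlgebra A] (f : A →⋆ₐ[ℂ] B) : Continuous f :=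
  (AddMonoidHomClass.lipschitz_of_bound f 1
    (fun a => by rw [one_mul]; exact NonUnitalStarAlgHom.norm_apply_le f a)).continuous

lemma UnivCStar.hom_ext {F : Type*} [Ring F] [StarRing F] [Algebra ℂ F] [StarModule ℂ F]
    (R : F → F → Prop) [Admissible R] {f g : UnivCStar R →⋆ₐ[ℂ] B}
    (h : ∀ a, f (UnivCStar.mk R a) = g (UnivCStar.mk R a)) : f = g := by
  refine StarAlgHom.ext fun x => ?_
  refine (maxSeminorm R).induction (P := fun x => f x = g x) x ?_ h
  exact isClosed_eq (continuous_starAlgHom f) (continuous_starAlgHom g)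

lemma UnivCStar.denseRange_mk {F : Type*} [Ring F] [StarRing F] [Algebra ℂ F] [StarModule ℂ F]
    (R : F → F → Prop) [Admissible R] : DenseRange (UnivCStar.mk R) :=
  (maxSeminorm R).denseRange_coe

namespace FreeStar

variable {X : Type*}

lemma star_of (x : X) : star (of x) = ofSum (Sum.inr x) := star_ofSum (Sum.inl x)

lemma adjoin_of : StarAlgebra.adjoin ℂ (Set.range (of : X → FreeStar X)) = ⊤ := by
  refine eq_top_iff.2 fun a _ => ?_
  induction a using induct with
  | hs c => exact algebraMap_mem _ c
  | ho x =>
    rcases x with x | x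
    · exact StarAlgebra.subset_adjoin ℂ _ ⟨x, rfl⟩
    · rw [← star_of]
      exact star_mem (StarAlgebra.subset_adjoin ℂ _ ⟨x, rfl⟩)
  | hm a b ha hb => exact mul_mem (ha trivial) (hb trivial)
  | ha a b ha hb => exact add_mem (ha trivial) (hb trivial)

lemma hom_ext {f g : FreeStar X →⋆ₐ[ℂ] B} (h : ∀ x, f (of x) = g (of x)) : f = g :=
  StarAlgHom.ext_of_adjoin_eq_top adjoin_of (by rintro _ ⟨x, rfl⟩; exact h x)

/-- The algebra homomorphism with prescribed values on the generators and their adjoints. -/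
def liftAlg (f : X → B) : FreeStar X →ₐ[ℂ] B :=
  FreeAlgebra.lift ℂ (Sum.elim f fun x => star (f x))

lemma liftAlg_ofSum (f : X → B) (x : X ⊕ X) :
    liftAlg f (ofSum x) = Sum.elim f (fun x => star (f x)) x :=
  FreeAlgebra.lift_ι_apply (R := ℂ) _ x

/-- The `*`-homomorphism with prescribed values on the generators. -/
def lift (f : X → B) : FreeStar X →⋆ₐ[ℂ] B where
  __ := liftAlg f
  map_star' a := by
    change liftAlg f (star a) = star (liftAlg f a)
    induction a using induct with
    | hs c =>
      rw [star_algebraMap, AlgHom.commutes, AlgHom.commutes, algebraMap_star_comm]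
    | ho x =>
      rw [star_ofSum, liftAlg_ofSum, liftAlg_ofSum]
      rcases x with x | x <;> simp
    | hm a b ha hb => rw [star_mul, map_mul, map_mul, star_mul, ha, hb]
    | ha a b ha hb => rw [star_add, map_add, map_add, star_add, ha, hb]

lemma lift_of (f : X → B) (x : X) : lift f (of x) = f x := liftAlg_ofSum f (Sum.inl x)

end FreeStar

/-- If the images of the free generators under a `*`-homomorphism with dense range lie in a set,
this set topologically generates. -/
lemma topologicalClosure_adjoin_eq_top {X : Type*} (f : FreeStar X →⋆ₐ[ℂ] B)
    (hf : DenseRange f) {s : Set B} (hs : ∀ x, f (FreeStar.of x) ∈ s) :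
    (StarAlgebra.adjoin ℂ s).topologicalClosure = ⊤ := by
  refine eq_top_iff.2 fun b _ => ?_
  have hsub : Set.range f ⊆ StarAlgebra.adjoin ℂ s := by
    rintro _ ⟨a, rfl⟩
    have h1 : (⊤ : StarSubalgebra ℂ (FreeStar X)) ≤ (StarAlgebra.adjoin ℂ s).comap f := by
      rw [← FreeStar.adjoin_of]
      refine StarAlgebra.adjoin_le ?_
      rintro _ ⟨x, rfl⟩
      exact StarAlgebra.subset_adjoin ℂ s (hs x)
    exact h1 trivial
  exact closure_mono hsub (hf b)

end Morphisms

/-! ### Universal properties of `C(O_n^{-1})` and of quantum symmetry algebras -/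

section Predicates

variable {I : Type*} [Fintype I] [DecidableEq I] {B : Type*} [Ring B] [StarRing B]

/-- The defining relations of `C(O_n^{-1})`. -/
structure IsSkewOrth (u : Matrix I I B) : Prop where
  real : ∀ i j, star (u i j) = u i j
  mul_transpose : u * u.transpose = 1
  transpose_mul : u.transpose * u = 1
  row : ∀ i j k, j ≠ k → u i j * u i k = -(u i k * u i j)
  col : ∀ i j k, j ≠ k → u j i * u k i = -(u k i * u j i)
  comm : ∀ i j k l, i ≠ k → j ≠ l → u i j * u k l = u k l * u i j

/-- A magic unitary matrix. -/
structure IsMagic (v : Matrix I I B) : Prop where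
  selfAdjoint : ∀ i j, star (v i j) = v i j
  idempotent : ∀ i j, v i j * v i j = v i j
  row_orth : ∀ i j k, j ≠ k → v i j * v i k = 0
  col_orth : ∀ i j k, j ≠ k → v j i * v k i = 0
  row_sum : ∀ i, ∑ j, v i j = 1
  col_sum : ∀ i, ∑ j, v j i = 1

/-- A magic unitary matrix that commutes with the adjacency matrix of a graph. -/
structure IsGraphMagic (G : SimpleGraph I) [DecidableRel G.Adj] (v : Matrix I I B) : Prop
    extends IsMagic v where
  graph : G.adjMatrix B * v = v * G.adjMatrix B

lemma IsSkewOrth.row_mul_row {u : Matrix I I B} (h : IsSkewOrth u) (i k : I) :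
    ∑ j, u i j * u k j = if i = k then 1 else 0 := by
  rw [← Matrix.one_apply, ← h.mul_transpose, Matrix.mul_apply]
  rfl

lemma IsSkewOrth.col_mul_col {u : Matrix I I B} (h : IsSkewOrth u) (j l : I) :
    ∑ i, u i j * u i l = if j = l then 1 else 0 := by
  rw [← Matrix.one_apply, ← h.transpose_mul, Matrix.mul_apply]
  rfl

lemma IsMagic.row_mul {v : Matrix I I B} (h : IsMagic v) (i j k : I) :
    v i j * v i k = if j = k then v i j else 0 := by
  split_ifs with hjk
  · rw [← hjk, h.idempotent]
  · exact h.row_orth i j k hjk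

lemma IsMagic.col_mul {v : Matrix I I B} (h : IsMagic v) (i j k : I) :
    v j i * v k i = if j = k then v j i else 0 := by
  split_ifs with hjk
  · rw [← hjk, h.idempotent]
  · exact h.col_orth i j k hjk

lemma IsMagic.transpose {v : Matrix I I B} (h : IsMagic v) : IsMagic v.transpose where
  selfAdjoint i j := h.selfAdjoint j i
  idempotent i j := h.idempotent j i
  row_orth i j k hjk := h.col_orth i j k hjk
  col_orth i j k hjk := h.row_orth i j k hjk
  row_sum i := h.col_sum i
  col_sum i := h.row_sum i

end Predicates

section Universal

variable (I : Type*) [Fintype I] [DecidableEq I]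

lemma map_matrix_apply {m : Type*} {A B : Type*} (M : Matrix m m A) (f : A → B) (i j : m) :
    M.map f i j = f (M i j) := rfl

lemma Ao.u_apply (i j : I) : Ao.u I i j = UnivCStar.mk (OrthRel I) (FreeStar.of (i, j)) := rfl

lemma As.u_apply (i j : I) : As.u I i j = UnivCStar.mk (MagicRel I) (FreeStar.of (i, j)) := rfl

lemma COneg.u_apply (i j : I) : COneg.u I i j = UnivCStar.mk (SkewRel I) (Ao.u I i j) := rfl

lemma map_one_apply {A B : Type*} [CStarAlgebra B] [Ring A] [StarRing A] [Algebra ℂ A]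
    (f : A →⋆ₐ[ℂ] B) (i j : I) :
    f ((1 : Matrix I I A) i j) = (1 : Matrix I I B) i j := by
  rw [Matrix.one_apply, Matrix.one_apply]
  split_ifs <;> simp

lemma Ao.u_mul_transpose : Ao.u I * (Ao.u I).transpose = 1 := by
  ext i j
  have := UnivCStar.mk_eq (OrthRel I) (OrthRel.mul_transpose i j)
  rw [map_one_apply, Matrix.mul_apply, map_sum] at this
  rw [← this, Matrix.mul_apply]
  exact Finset.sum_congr rfl fun k _ => by rw [map_mul]; rfl

lemma Ao.transpose_mul_u : (Ao.u I).transpose * Ao.u I = 1 := by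
  ext i j
  have := UnivCStar.mk_eq (OrthRel I) (OrthRel.transpose_mul i j)
  rw [map_one_apply, Matrix.mul_apply, map_sum] at this
  rw [← this, Matrix.mul_apply]
  exact Finset.sum_congr rfl fun k _ => by rw [map_mul]; rfl

lemma COneg.isSkewOrth_u : IsSkewOrth (COneg.u I) where
  real i j := by
    rw [COneg.u_apply, ← map_star, Ao.u_apply, ← map_star]
    exact congrArg _ (UnivCStar.mk_eq (OrthRel I) (OrthRel.real i j))
  mul_transpose := by
    ext i j
    rw [← map_one_apply I (UnivCStar.mk (SkewRel I)), ← Ao.u_mul_transpose, Matrix.mul_apply,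
      Matrix.mul_apply, map_sum]
    exact Finset.sum_congr rfl fun k _ => by rw [map_mul]; rfl
  transpose_mul := by
    ext i j
    rw [← map_one_apply I (UnivCStar.mk (SkewRel I)), ← Ao.transpose_mul_u, Matrix.mul_apply,
      Matrix.mul_apply, map_sum]
    exact Finset.sum_congr rfl fun k _ => by rw [map_mul]; rfl
  row i j k h := by
    have := UnivCStar.mk_eq (SkewRel I) (SkewRel.row i j k h)
    rwa [map_neg, map_mul, map_mul] at this
  col i j k h := by
    have := UnivCStar.mk_eq (SkewRel I) (SkewRel.col i j k h)
    rwa [map_neg, map_mul, map_mul] at this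
  comm i j k l hik hjl := by
    have := UnivCStar.mk_eq (SkewRel I) (SkewRel.comm i j k l hik hjl)
    rwa [map_mul, map_mul] at this

variable {I} {B : Type*} [CStarAlgebra B]

/-- The morphism from `A_o(n)` attached to an orthogonal matrix. -/
def Ao.lift (w : Matrix I I B) (h : IsSkewOrth w) : Ao I →⋆ₐ[ℂ] B :=
  UnivCStar.lift (OrthRel I) (FreeStar.lift fun x => w x.1 x.2) (by
    have e : ∀ i j, FreeStar.lift (fun x : I × I => w x.1 x.2) (freeMatrix I i j) = w i j :=
      fun i j => FreeStar.lift_of _ _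
    rintro _ _ (⟨i, j⟩ | ⟨i, j⟩ | ⟨i, j⟩)
    · rw [map_star, e, h.real]
    · rw [map_one_apply, ← h.mul_transpose, Matrix.mul_apply, Matrix.mul_apply, map_sum]
      exact Finset.sum_congr rfl fun k _ => by
        rw [map_mul, Matrix.transpose_apply, e, e, Matrix.transpose_apply]
    · rw [map_one_apply, ← h.transpose_mul, Matrix.mul_apply, Matrix.mul_apply, map_sum]
      exact Finset.sum_congr rfl fun k _ => by
        rw [map_mul, Matrix.transpose_apply, e, e, Matrix.transpose_apply])

lemma Ao.lift_u (w : Matrix I I B) (h : IsSkewOrth w) (i j : I) :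
    Ao.lift w h (Ao.u I i j) = w i j := by
  rw [Ao.u_apply, Ao.lift, UnivCStar.lift_mk, FreeStar.lift_of]

/-- The morphism from `C(O_n^{-1})` attached to a matrix satisfying its relations. -/
def COneg.lift (w : Matrix I I B) (h : IsSkewOrth w) : COneg I →⋆ₐ[ℂ] B :=
  UnivCStar.lift (SkewRel I) (Ao.lift w h) (by
    rintro _ _ (⟨i, j, k, hjk⟩ | ⟨i, j, k, hjk⟩ | ⟨i, j, k, l, hik, hjl⟩)
    · simpa only [map_mul, map_neg, Ao.lift_u] using h.row i j k hjk
    · simpa only [map_mul, map_neg, Ao.lift_u] using h.col i j k hjk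
    · simpa only [map_mul, Ao.lift_u] using h.comm i j k l hik hjl)

lemma COneg.lift_u (w : Matrix I I B) (h : IsSkewOrth w) (i j : I) :
    COneg.lift w h (COneg.u I i j) = w i j := by
  rw [COneg.u_apply, COneg.lift, UnivCStar.lift_mk, Ao.lift_u]

/-- Two successive completions separate this algebra from the free `*`-algebra; density removes them
one at a time. -/
lemma COneg.hom_ext {f g : COneg I →⋆ₐ[ℂ] B}
    (h : ∀ i j, f (COneg.u I i j) = g (COneg.u I i j)) : f = g := by
  refine UnivCStar.hom_ext _ fun a => ?_
  refine DFunLike.congr_fun (f := f.comp (UnivCStar.mk (SkewRel I)))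
    (g := g.comp (UnivCStar.mk (SkewRel I))) ?_ a
  refine UnivCStar.hom_ext _ fun a => ?_
  refine DFunLike.congr_fun
    (f := (f.comp (UnivCStar.mk (SkewRel I))).comp (UnivCStar.mk (OrthRel I)))
    (g := (g.comp (UnivCStar.mk (SkewRel I))).comp (UnivCStar.mk (OrthRel I))) ?_ a
  exact FreeStar.hom_ext fun x => h x.1 x.2

variable (I) in
lemma COneg.dense :
    (StarAlgebra.adjoin ℂ {a | ∃ i j, a = COneg.u I i j}).topologicalClosure = ⊤ :=
  topologicalClosure_adjoin_eq_top ((UnivCStar.mk (SkewRel I)).comp (UnivCStar.mk (OrthRel I)))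
    ((UnivCStar.denseRange_mk (SkewRel I)).comp (UnivCStar.denseRange_mk (OrthRel I))
      (continuous_starAlgHom _)) (fun x => ⟨x.1, x.2, rfl⟩)

variable (G : SimpleGraph I) [DecidableRel G.Adj]

lemma QSym.u_apply (i j : I) : QSym.u G i j = UnivCStar.mk (GraphRel G) (As.u I i j) := rfl

lemma map_adjMatrix_apply {A : Type*} [CStarAlgebra A] (f : A →⋆ₐ[ℂ] B) (i j : I) :
    f (G.adjMatrix A i j) = G.adjMatrix B i j := by
  rw [SimpleGraph.adjMatrix_apply, SimpleGraph.adjMatrix_apply]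
  split_ifs <;> simp

variable (I) in
lemma As.isMagic_u : IsMagic (As.u I) where
  selfAdjoint i j := by
    rw [As.u_apply, ← map_star]
    exact UnivCStar.mk_eq (MagicRel I) (MagicRel.selfAdjoint i j)
  idempotent i j := by
    rw [As.u_apply, ← map_mul]
    exact UnivCStar.mk_eq (MagicRel I) (MagicRel.idempotent i j)
  row_orth i j k h := by
    rw [As.u_apply, As.u_apply, ← map_mul, ← map_zero (UnivCStar.mk (MagicRel I))]
    exact UnivCStar.mk_eq (MagicRel I) (MagicRel.row_orth i j k h)
  col_orth i j k h := by
    rw [As.u_apply, As.u_apply, ← map_mul, ← map_zero (UnivCStar.mk (MagicRel I))]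
    exact UnivCStar.mk_eq (MagicRel I) (MagicRel.col_orth i j k h)
  row_sum i := by
    rw [← map_one (UnivCStar.mk (MagicRel I)), ← UnivCStar.mk_eq (MagicRel I) (MagicRel.row_sum i),
      map_sum]
    rfl
  col_sum i := by
    rw [← map_one (UnivCStar.mk (MagicRel I)), ← UnivCStar.mk_eq (MagicRel I) (MagicRel.col_sum i),
      map_sum]
    rfl

lemma IsMagic.map {A : Type*} [CStarAlgebra A] {v : Matrix I I A} (h : IsMagic v)
    (f : A →⋆ₐ[ℂ] B) : IsMagic (v.map f) where
  selfAdjoint i j := by rw [map_matrix_apply, ← map_star, h.selfAdjoint]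
  idempotent i j := by rw [map_matrix_apply, ← map_mul, h.idempotent]
  row_orth i j k hjk := by
    rw [map_matrix_apply, map_matrix_apply, ← map_mul, h.row_orth i j k hjk, map_zero]
  col_orth i j k hjk := by
    rw [map_matrix_apply, map_matrix_apply, ← map_mul, h.col_orth i j k hjk, map_zero]
  row_sum i := by
    simp only [map_matrix_apply]
    rw [← map_sum, h.row_sum, map_one]
  col_sum i := by
    simp only [map_matrix_apply]
    rw [← map_sum, h.col_sum, map_one]

lemma QSym.isGraphMagic_u : IsGraphMagic G (QSym.u G) where
  toIsMagic := (As.isMagic_u I).map (UnivCStar.mk (GraphRel G))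
  graph := by
    ext i j
    have h := UnivCStar.mk_eq (GraphRel G) (GraphRel.comm i j)
    simp only [Matrix.mul_apply, map_sum, map_mul, map_adjMatrix_apply] at h
    simp only [Matrix.mul_apply]
    exact h

/-- The morphism from `A_s(n)` attached to a magic unitary matrix. -/
def As.lift (w : Matrix I I B) (h : IsMagic w) : As I →⋆ₐ[ℂ] B :=
  UnivCStar.lift (MagicRel I) (FreeStar.lift fun x => w x.1 x.2) (by
    have e : ∀ i j, FreeStar.lift (fun x : I × I => w x.1 x.2) (freeMatrix I i j) = w i j :=
      fun i j => FreeStar.lift_of _ _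
    rintro _ _ (⟨i, j⟩ | ⟨i, j⟩ | ⟨i, j, k, hjk⟩ | ⟨i, j, k, hjk⟩ | ⟨i⟩ | ⟨i⟩)
    · rw [map_star, e, h.selfAdjoint]
    · rw [map_mul, e, h.idempotent]
    · rw [map_mul, e, e, h.row_orth i j k hjk, map_zero]
    · rw [map_mul, e, e, h.col_orth i j k hjk, map_zero]
    · simp only [map_sum, e, h.row_sum, map_one]
    · simp only [map_sum, e, h.col_sum, map_one])

lemma As.lift_u (w : Matrix I I B) (h : IsMagic w) (i j : I) :
    As.lift w h (As.u I i j) = w i j := by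
  rw [As.u_apply, As.lift, UnivCStar.lift_mk, FreeStar.lift_of]

variable {G}

/-- The morphism from the quantum symmetry algebra of a graph attached to a magic unitary matrix
that commutes with the adjacency matrix. -/
def QSym.lift (w : Matrix I I B) (h : IsGraphMagic G w) : QSym G →⋆ₐ[ℂ] B :=
  UnivCStar.lift (GraphRel G) (As.lift w h.toIsMagic) (by
    rintro _ _ ⟨i, j⟩
    have h' := congrFun (congrFun h.graph i) j
    simp only [Matrix.mul_apply] at h'
    simpa only [Matrix.mul_apply, map_sum, map_mul, map_adjMatrix_apply, As.lift_u] using h')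

lemma QSym.lift_u (w : Matrix I I B) (h : IsGraphMagic G w) (i j : I) :
    QSym.lift w h (QSym.u G i j) = w i j := by
  rw [QSym.u_apply, QSym.lift, UnivCStar.lift_mk, As.lift_u]

lemma QSym.hom_ext {f g : QSym G →⋆ₐ[ℂ] B}
    (h : ∀ i j, f (QSym.u G i j) = g (QSym.u G i j)) : f = g := by
  refine UnivCStar.hom_ext _ fun a => ?_
  refine DFunLike.congr_fun (f := f.comp (UnivCStar.mk (GraphRel G)))
    (g := g.comp (UnivCStar.mk (GraphRel G))) ?_ a
  refine UnivCStar.hom_ext _ fun a => ?_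
  refine DFunLike.congr_fun
    (f := (f.comp (UnivCStar.mk (GraphRel G))).comp (UnivCStar.mk (MagicRel I)))
    (g := (g.comp (UnivCStar.mk (GraphRel G))).comp (UnivCStar.mk (MagicRel I))) ?_ a
  exact FreeStar.hom_ext fun x => h x.1 x.2

variable (G) in
lemma QSym.dense :
    (StarAlgebra.adjoin ℂ {a | ∃ i j, a = QSym.u G i j}).topologicalClosure = ⊤ :=
  topologicalClosure_adjoin_eq_top ((UnivCStar.mk (GraphRel G)).comp (UnivCStar.mk (MagicRel I)))
    ((UnivCStar.denseRange_mk (GraphRel G)).comp (UnivCStar.denseRange_mk (MagicRel I))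
      (continuous_starAlgHom _)) (fun x => ⟨x.1, x.2, rfl⟩)

end Universal

/-! ### Harmonic analysis on the hypercube -/

section Cube

variable {I : Type*}

/-- A sign, as a complex number. -/
def sgn (e : ℤˣ) : ℂ := ((e : ℤ) : ℂ)

lemma sgn_mul_self (e : ℤˣ) : sgn e * sgn e = 1 := by
  rcases Int.units_eq_one_or e with rfl | rfl <;> simp [sgn]

lemma sgn_neg (e : ℤˣ) : sgn (-e) = -sgn e := by simp [sgn]

lemma star_sgn (e : ℤˣ) : star (sgn e) = sgn e := by
  rcases Int.units_eq_one_or e with rfl | rfl <;> simp [sgn]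

lemma sgn_ne {e e' : ℤˣ} (h : e ≠ e') : sgn e' = -sgn e := by
  rw [← sgn_neg]
  congr 1
  rcases Int.units_eq_one_or e with rfl | rfl <;> rcases Int.units_eq_one_or e' with rfl | rfl <;>
    simp_all

variable [DecidableEq I]

/-- Changes the sign of the `i`-th coordinate. -/
def flip (x : I → ℤˣ) (i : I) : I → ℤˣ := Function.update x i (-x i)

lemma flip_self (x : I → ℤˣ) (i : I) : flip x i i = -x i := Function.update_self _ _ _

lemma flip_of_ne (x : I → ℤˣ) {i j : I} (h : j ≠ i) : flip x i j = x j :=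
  Function.update_of_ne h _ _

lemma flip_flip (x : I → ℤˣ) (i : I) : flip (flip x i) i = x := by
  ext1 j
  by_cases h : j = i
  · subst h; rw [flip_self, flip_self, neg_neg]
  · rw [flip_of_ne _ h, flip_of_ne _ h]

lemma sgn_flip (x : I → ℤˣ) (i j : I) :
    sgn (flip x i j) = if j = i then -sgn (x j) else sgn (x j) := by
  split_ifs with h
  · subst h; rw [flip_self, sgn_neg]
  · rw [flip_of_ne _ h]

/-- The reflection in the `i`-th coordinate hyperplane. -/
def flipEquiv (i : I) : (I → ℤˣ) ≃ (I → ℤˣ) :=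
  Function.Involutive.toPerm (fun x => flip x i) (fun x => flip_flip x i)

variable [Fintype I]

lemma sum_flip {M : Type*} [AddCommMonoid M] (i : I) (F : (I → ℤˣ) → M) :
    ∑ x, F (flip x i) = ∑ x, F x :=
  Equiv.sum_comp (flipEquiv i) F

/-- The character of the hypercube attached to a set of coordinates. -/
def chi (S : Finset I) (x : I → ℤˣ) : ℂ := ∏ i ∈ S, sgn (x i)

lemma chi_flip (S : Finset I) (x : I → ℤˣ) (i : I) :
    chi S (flip x i) = if i ∈ S then -chi S x else chi S x := by
  unfold chi
  split_ifs with h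
  · rw [← Finset.mul_prod_erase S _ h, ← Finset.mul_prod_erase S (fun j => sgn (x j)) h, flip_self,
      sgn_neg, neg_mul]
    congr 2
    exact Finset.prod_congr rfl fun j hj => by rw [flip_of_ne _ (Finset.ne_of_mem_erase hj)]
  · exact Finset.prod_congr rfl fun j hj => by
      rw [flip_of_ne]; rintro rfl; exact h hj

/-- Characters diagonalize the adjacency operator: exactly `S.card` of the neighbours of `x` carry
the opposite value. -/
lemma sum_chi_flip (S : Finset I) (x : I → ℤˣ) :
    ∑ i, chi S (flip x i) = ((Fintype.card I : ℂ) - 2 * S.card) * chi S x := by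
  have h : ∀ i, chi S (flip x i) = chi S x - if i ∈ S then 2 * chi S x else 0 := fun i => by
    rw [chi_flip]; split_ifs <;> ring
  simp only [h, Finset.sum_sub_distrib, Finset.sum_ite_mem, Finset.univ_inter, Finset.sum_const,
    Finset.card_univ, nsmul_eq_mul]
  ring

/-- The sum over `S` is the expansion of ∏_i (1 + x_i y_i), and a coordinate where `x` and `y`
differ contributes a zero factor. -/
lemma sum_chi_mul_chi (x y : I → ℤˣ) :
    ∑ S : Finset I, chi S x * chi S y = if x = y then 2 ^ Fintype.card I else 0 := by
  have h : ∑ S : Finset I, chi S x * chi S y = ∏ i, (1 + sgn (x i) * sgn (y i)) := by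
    rw [Finset.prod_one_add, Finset.powerset_univ]
    exact Finset.sum_congr rfl fun S _ => (Finset.prod_mul_distrib).symm
  rw [h]
  split_ifs with hxy
  · subst hxy
    simp only [sgn_mul_self, Finset.prod_const, Finset.card_univ]
    norm_num
  · obtain ⟨i, hi⟩ := Function.ne_iff.1 hxy
    refine Finset.prod_eq_zero (Finset.mem_univ i) ?_
    rw [sgn_ne hi, mul_neg, sgn_mul_self, add_neg_cancel]

lemma sum_sgn_mul_sgn (i k : I) :
    ∑ x : I → ℤˣ, sgn (x i) * sgn (x k) = if i = k then 2 ^ Fintype.card I else 0 := by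
  split_ifs with h
  · subst h
    simp [sgn_mul_self]
  -- Flipping the coordinate `i` changes the sign of the summand, so the sum is its own negative.
  · have := sum_flip i fun x : I → ℤˣ => sgn (x i) * sgn (x k)
    simp only [sgn_flip, if_true, if_neg (Ne.symm h), neg_mul, Finset.sum_neg_distrib] at this
    linear_combination (-1 / 2 : ℂ) * this

/-! ### Fourier analysis of vector-valued functions on the cube -/

variable {M : Type*} [AddCommGroup M] [Module ℂ M]

lemma fourier_inversion (F : (I → ℤˣ) → M) (x : I → ℤˣ) :
    ∑ S : Finset I, chi S x • ∑ y, chi S y • F y = (2 ^ Fintype.card I : ℂ) • F x := by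
  simp only [Finset.smul_sum, smul_smul]
  rw [Finset.sum_comm]
  simp only [← Finset.sum_smul, sum_chi_mul_chi, ite_smul, zero_smul, Finset.sum_ite_eq,
    Finset.mem_univ, if_true]

/-- The Fourier coefficients of an eigenvector of the adjacency matrix of the hypercube are
concentrated in one degree. -/
lemma fourier_eq_zero {F : (I → ℤˣ) → M} {k : ℕ}
    (hF : ∀ x, ∑ i, F (flip x i) = ((Fintype.card I : ℂ) - 2 * k) • F x) {S : Finset I}
    (hS : S.card ≠ k) : ∑ x, chi S x • F x = 0 := by
  -- The sum over neighbours is paired with the character in two ways: through the eigenvalue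
  -- equation for `F`, and, moving the flips onto `chi S`, through that for the character. Different
  -- degrees have different eigenvalues.
  have h1 : ∑ x, chi S x • ∑ i, F (flip x i) =
      ((Fintype.card I : ℂ) - 2 * k) • ∑ x, chi S x • F x := by
    simp only [hF, Finset.smul_sum, smul_smul, mul_comm]
  have h2 : ∑ x, chi S x • ∑ i, F (flip x i) =
      ((Fintype.card I : ℂ) - 2 * S.card) • ∑ x, chi S x • F x := by
    simp only [Finset.smul_sum]
    rw [Finset.sum_comm]
    have h3 : ∀ i, ∑ x, chi S x • F (flip x i) = ∑ x, chi S (flip x i) • F x := fun i => by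
      rw [← sum_flip i]
      simp only [flip_flip]
    simp only [h3]
    rw [Finset.sum_comm]
    exact Finset.sum_congr rfl fun x _ => by rw [← Finset.sum_smul, sum_chi_flip, smul_smul]
  have h4 : ((2 : ℂ) * (S.card - k)) • ∑ x, chi S x • F x = 0 := by
    have h5 := h1.symm.trans h2
    rw [← sub_eq_zero, ← sub_smul] at h5
    rw [← h5]
    congr 1
    ring
  refine (smul_eq_zero.1 h4).resolve_left (mul_ne_zero two_ne_zero (sub_ne_zero.2 ?_))
  exact_mod_cast hS

lemma two_pow_ne_zero : (2 ^ Fintype.card I : ℂ) ≠ 0 := pow_ne_zero _ two_ne_zero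

/-- Harmonic functions on the hypercube are constant. -/
lemma smul_eq_sum_of_harmonic {F : (I → ℤˣ) → M}
    (hF : ∀ x, ∑ i, F (flip x i) = (Fintype.card I : ℂ) • F x) (x : I → ℤˣ) :
    (2 ^ Fintype.card I : ℂ) • F x = ∑ y, F y := by
  -- The eigenvalue is that of degree 0, where the only character is the constant one.
  rw [← fourier_inversion F x, Finset.sum_eq_single ∅]
  · simp [chi]
  · intro S _ hS
    rw [fourier_eq_zero (k := 0) (by simpa using hF) (by simpa using hS), smul_zero]
  · simp

/-- Eigenvectors of degree one are linear. -/
lemma smul_eq_sum_of_linear {F : (I → ℤˣ) → M}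
    (hF : ∀ x, ∑ i, F (flip x i) = ((Fintype.card I : ℂ) - 2) • F x) (x : I → ℤˣ) :
    (2 ^ Fintype.card I : ℂ) • F x = ∑ i, sgn (x i) • ∑ y, sgn (y i) • F y := by
  -- In degree 1 the characters are those of singletons, that is, the coordinate functions.
  rw [← fourier_inversion F x,
    ← Finset.sum_subset (Finset.subset_univ (Finset.powersetCard 1 Finset.univ))]
  · rw [Finset.powersetCard_one, Finset.sum_map]
    simp [chi]
  · intro S _ hS
    rw [fourier_eq_zero (k := 1) (by simpa using hF) (by simpa [Finset.mem_powersetCard] using hS),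
      smul_zero]

/-! ### Adjacency in the cube expressed through coordinate flips -/

lemma hammingDist_eq_one_iff (x y : I → ℤˣ) : hammingDist x y = 1 ↔ ∃ i, flip x i = y := by
  rw [hammingDist, Finset.card_eq_one]
  constructor
  · rintro ⟨i, hi⟩
    refine ⟨i, funext fun j => ?_⟩
    have hj := Finset.ext_iff.1 hi j
    simp only [Finset.mem_filter, Finset.mem_univ, true_and, Finset.mem_singleton] at hj
    by_cases h : j = i
    · have hne := hj.2 h
      subst h
      rw [flip_self]
      rcases Int.units_eq_one_or (x j) with h1 | h1 <;>
        rcases Int.units_eq_one_or (y j) with h2 | h2 <;> simp_all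
    · rw [flip_of_ne _ h]
      exact not_not.1 fun h' => h (hj.1 h')
  · rintro ⟨i, rfl⟩
    refine ⟨i, Finset.ext fun j => ?_⟩
    simp only [Finset.mem_filter, Finset.mem_univ, true_and, Finset.mem_singleton]
    by_cases h : j = i
    · subst h
      rw [flip_self]
      simp only [iff_true]
      rcases Int.units_eq_one_or (x j) with h1 | h1 <;> rw [h1] <;> decide
    · simp [flip_of_ne _ h, h]

lemma flip_injective (x : I → ℤˣ) : Function.Injective (flip x) := by
  intro i j h
  by_contra hij
  have := congrFun h i
  rw [flip_self, flip_of_ne _ hij] at this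
  rcases Int.units_eq_one_or (x i) with h1 | h1 <;> rw [h1] at this <;>
    exact absurd this (by decide)

lemma sum_hammingDist_eq_one {N : Type*} [AddCommMonoid N] (x : I → ℤˣ) (F : (I → ℤˣ) → N) :
    ∑ y, (if hammingDist x y = 1 then F y else 0) = ∑ i, F (flip x i) := by
  rw [← Finset.sum_filter]
  have : Finset.univ.filter (fun y => hammingDist x y = 1) = Finset.univ.image (flip x) := by
    ext y
    simp [hammingDist_eq_one_iff]
  rw [this, Finset.sum_image fun i _ j _ h => flip_injective x h]

end Cube

lemma hypercube_adjMatrix_mul {n : ℕ} {B : Type*} [Ring B]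
    (v : Matrix (Fin n → ℤˣ) (Fin n → ℤˣ) B) (x y : Fin n → ℤˣ) :
    ((hypercube n).adjMatrix B * v) x y = ∑ i, v (flip x i) y := by
  rw [Matrix.mul_apply, ← sum_hammingDist_eq_one x fun z => v z y]
  refine Finset.sum_congr rfl fun z _ => ?_
  rw [SimpleGraph.adjMatrix_apply, ite_mul, one_mul, zero_mul]
  rfl

lemma mul_hypercube_adjMatrix {n : ℕ} {B : Type*} [Ring B]
    (v : Matrix (Fin n → ℤˣ) (Fin n → ℤˣ) B) (x y : Fin n → ℤˣ) :
    (v * (hypercube n).adjMatrix B) x y = ∑ i, v x (flip y i) := by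
  rw [Matrix.mul_apply, ← sum_hammingDist_eq_one y fun z => v x z]
  refine Finset.sum_congr rfl fun z _ => ?_
  rw [SimpleGraph.adjMatrix_apply, mul_ite, mul_one, mul_zero]
  exact if_congr (by rw [(hypercube n).adj_comm]; rfl) rfl rfl

/-! ### From skew orthogonal matrices to magic unitaries -/

section SkewToMagic

variable {I : Type*} [Fintype I] [DecidableEq I] {B : Type*} [Ring B] [StarRing B] [Algebra ℂ B]

/-- The signed sum of the `j`-th column of `u`. -/
def colSum (u : Matrix I I B) (j : I) (x : I → ℤˣ) : B := ∑ i, sgn (x i) • u i j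

lemma colSum_flip (u : Matrix I I B) (i j : I) (x : I → ℤˣ) :
    colSum u j (flip x i) = colSum u j x - (2 * sgn (x i)) • u i j := by
  have h : ∀ k, sgn (flip x i k) • u k j =
      sgn (x k) • u k j - if k = i then (2 * sgn (x k)) • u k j else 0 := fun k => by
    rw [sgn_flip]
    split_ifs
    · module
    · rw [sub_zero]
  simp only [colSum, h, Finset.sum_sub_distrib, Finset.sum_ite_eq', Finset.mem_univ, if_true]

section Ring

variable {u : Matrix I I B}

/-- Moving `u i j` past the sum costs a sign only at the term `u i l` of the same row, and the flip
at `i` compensates for it. -/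
lemma IsSkewOrth.mul_colSum_flip (h : IsSkewOrth u) {i j l : I} (hjl : j ≠ l) (x : I → ℤˣ) :
    u i j * colSum u l (flip x i) = colSum u l x * u i j := by
  rw [colSum, colSum, Finset.mul_sum, Finset.sum_mul]
  refine Finset.sum_congr rfl fun k _ => ?_
  rw [mul_smul_comm, smul_mul_assoc, sgn_flip]
  split_ifs with hk
  · subst hk
    rw [h.row k j l hjl, neg_smul, smul_neg, neg_neg]
  · rw [h.comm i j k l (Ne.symm hk) hjl]

/-- Within one column every other entry anticommutes with `u i j`; the term `u i j` itself commutes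
but gets its sign from the flip. -/
lemma IsSkewOrth.mul_colSum_flip_self (h : IsSkewOrth u) (i j : I) (x : I → ℤˣ) :
    u i j * colSum u j (flip x i) = -(colSum u j x * u i j) := by
  rw [colSum, colSum, Finset.mul_sum, Finset.sum_mul, ← Finset.sum_neg_distrib]
  refine Finset.sum_congr rfl fun k _ => ?_
  rw [mul_smul_comm, smul_mul_assoc, sgn_flip]
  split_ifs with hk
  · subst hk
    rw [neg_smul]
  · rw [h.col j i k (Ne.symm hk), smul_neg]

/-- Undoing the flip in `mul_colSum_flip` shows that the commutator is 2 ∑_i u_ij u_il, which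
vanishes by orthogonality of the columns. -/
lemma IsSkewOrth.colSum_mul_colSum_comm (h : IsSkewOrth u) {j l : I} (hjl : j ≠ l) (x : I → ℤˣ) :
    colSum u j x * colSum u l x = colSum u l x * colSum u j x := by
  have h1 : ∀ i, u i j * colSum u l x =
      colSum u l x * u i j + (2 * sgn (x i)) • (u i j * u i l) := fun i => by
    rw [← h.mul_colSum_flip hjl x, colSum_flip, mul_sub, mul_smul_comm, sub_add_cancel]
  calc colSum u j x * colSum u l x = ∑ i, sgn (x i) • (u i j * colSum u l x) := by
        conv_lhs => rw [colSum, Finset.sum_mul]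
        simp only [smul_mul_assoc]
    _ = ∑ i, sgn (x i) • (colSum u l x * u i j) + (2 : ℂ) • ∑ i, u i j * u i l := by
        rw [Finset.smul_sum, ← Finset.sum_add_distrib]
        refine Finset.sum_congr rfl fun i _ => ?_
        rw [h1, smul_add, smul_smul, mul_left_comm, sgn_mul_self, mul_one]
    _ = colSum u l x * colSum u j x := by
        rw [h.col_mul_col, if_neg hjl, smul_zero, add_zero]
        conv_rhs => rw [colSum.eq_def u j, Finset.mul_sum]
        simp only [mul_smul_comm]

/-- Here undoing the flip gives s² = -s² + 2 ∑_i u_ij², and the column has length 1. -/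
lemma IsSkewOrth.colSum_mul_self (h : IsSkewOrth u) (j : I)
    (x : I → ℤˣ) : colSum u j x * colSum u j x = 1 := by
  have h1 : ∀ i, u i j * colSum u j x =
      -(colSum u j x * u i j) + (2 * sgn (x i)) • (u i j * u i j) := fun i => by
    rw [← h.mul_colSum_flip_self i j x, colSum_flip, mul_sub, mul_smul_comm, sub_add_cancel]
  have h2 : colSum u j x * colSum u j x = -(colSum u j x * colSum u j x) + (2 : ℂ) • (1 : B) :=
    calc colSum u j x * colSum u j x = ∑ i, sgn (x i) • (u i j * colSum u j x) := by
          conv_lhs => rw [colSum, Finset.sum_mul]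
          simp only [smul_mul_assoc]
          rfl
      _ = -∑ i, sgn (x i) • (colSum u j x * u i j) + (2 : ℂ) • ∑ i, u i j * u i j := by
          rw [Finset.smul_sum, ← Finset.sum_neg_distrib, ← Finset.sum_add_distrib]
          refine Finset.sum_congr rfl fun i _ => ?_
          rw [h1, smul_add, smul_smul, mul_left_comm, sgn_mul_self, mul_one, smul_neg]
      _ = -(colSum u j x * colSum u j x) + (2 : ℂ) • (1 : B) := by
          rw [h.col_mul_col, if_pos rfl]
          simp only [← mul_smul_comm, ← Finset.mul_sum]
          rfl
  have h3 : (2 : ℂ) • (colSum u j x * colSum u j x) = (2 : ℂ) • (1 : B) := by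
    rw [two_smul]
    nth_rewrite 1 [h2]
    abel
  exact smul_right_injective B (two_ne_zero (α := ℂ)) h3

end Ring

/-- The spectral projection of `colSum u j x` for the eigenvalue `y j`. -/
def colProj (u : Matrix I I B) (x y : I → ℤˣ) (j : I) : B :=
  (1 / 2 : ℂ) • (1 + sgn (y j) • colSum u j x)

/-- The product of the projections `colProj u x y j`. -/
def projProd (u : Matrix I I B) (L : List I) (x y : I → ℤˣ) : B := (L.map (colProj u x y)).prod

lemma projProd_cons (u : Matrix I I B) (j : I) (L : List I) (x y : I → ℤˣ) :
    projProd u (j :: L) x y = colProj u x y j * projProd u L x y := by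
  rw [projProd, List.map_cons, List.prod_cons, projProd]

lemma projProd_flip_right (u : Matrix I I B) {j : I} {L : List I} (hj : j ∉ L) (x y : I → ℤˣ) :
    projProd u L x (flip y j) = projProd u L x y := by
  unfold projProd
  congr 1
  refine List.map_congr_left fun l hl => ?_
  rw [colProj, flip_of_ne, colProj]
  rintro rfl
  exact hj hl

lemma colProj_flip_right_of_ne (u : Matrix I I B) {i j : I} (hij : j ≠ i) (x y : I → ℤˣ) :
    colProj u x (flip y i) j = colProj u x y j := by
  rw [colProj, flip_of_ne _ hij, colProj]

lemma colProj_flip_right_self (u : Matrix I I B) (j : I) (x y : I → ℤˣ) :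
    colProj u x (flip y j) j = colProj u x y j - sgn (y j) • colSum u j x := by
  rw [colProj, flip_self, colProj, sgn_neg]
  module

lemma colProj_flip_left (u : Matrix I I B) (i j : I) (x y : I → ℤˣ) :
    colProj u (flip x i) y j = colProj u x y j - (sgn (y j) * sgn (x i)) • u i j := by
  rw [colProj, colSum_flip, colProj]
  module

section Ring

variable {u : Matrix I I B}

lemma IsSkewOrth.commute_colSum (h : IsSkewOrth u) (j l : I) (x : I → ℤˣ) :
    Commute (colSum u j x) (colSum u l x) := by
  by_cases hjl : j = l
  · subst hjl; exact Commute.refl _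
  · exact h.colSum_mul_colSum_comm hjl x

lemma IsSkewOrth.commute_colSum_colProj (h : IsSkewOrth u) (j l : I) (x y : I → ℤˣ) :
    Commute (colSum u j x) (colProj u x y l) :=
  ((Commute.one_right _).add_right ((h.commute_colSum j l x).smul_right _)).smul_right _

lemma IsSkewOrth.commute_colProj (h : IsSkewOrth u) (j l : I) (x y z : I → ℤˣ) :
    Commute (colProj u x y j) (colProj u x z l) :=
  ((Commute.one_left _).add_left ((h.commute_colSum_colProj j l x z).smul_left _)).smul_left _

lemma IsSkewOrth.commute_colSum_projProd (h : IsSkewOrth u) (j : I) (L : List I) (x y : I → ℤˣ) :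
    Commute (colSum u j x) (projProd u L x y) :=
  Commute.list_prod_right _ _ fun b hb => by
    obtain ⟨l, _, rfl⟩ := List.mem_map.1 hb
    exact h.commute_colSum_colProj j l x y

lemma IsSkewOrth.commute_colProj_projProd (h : IsSkewOrth u) (j : I) (L : List I) (x y z : I → ℤˣ) :
    Commute (colProj u x y j) (projProd u L x z) :=
  ((Commute.one_left _).add_left ((h.commute_colSum_projProd j L x z).smul_left _)).smul_left _

lemma IsSkewOrth.colProj_mul_self (h : IsSkewOrth u) (j : I) (x y : I → ℤˣ) :
    colProj u x y j * colProj u x y j = colProj u x y j := by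
  rw [colProj, smul_mul_smul_comm, mul_add, add_mul, add_mul, smul_mul_smul_comm, sgn_mul_self,
    h.colSum_mul_self, one_mul, one_mul, mul_one]
  module

lemma IsSkewOrth.colProj_mul_of_ne (h : IsSkewOrth u) {j : I} {y z : I → ℤˣ} (hyz : y j ≠ z j)
    (x : I → ℤˣ) :
    colProj u x y j * colProj u x z j = 0 := by
  rw [colProj, colProj, sgn_ne hyz, smul_mul_smul_comm, mul_add, add_mul, add_mul,
    smul_mul_smul_comm, mul_neg, sgn_mul_self, h.colSum_mul_self, one_mul, one_mul, mul_one]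
  module

lemma IsSkewOrth.colSum_mul_colProj (h : IsSkewOrth u) (j : I) (x y : I → ℤˣ) :
    colSum u j x * colProj u x y j = sgn (y j) • colProj u x y j := by
  rw [colProj, mul_smul_comm, mul_add, mul_smul_comm, h.colSum_mul_self, mul_one,
    smul_comm (sgn (y j)) (1 / 2 : ℂ), smul_add (sgn (y j)), smul_smul (sgn (y j)), sgn_mul_self,
    one_smul, add_comm]

lemma IsSkewOrth.projProd_mul_self (h : IsSkewOrth u) (L : List I) (x y : I → ℤˣ) :
    projProd u L x y * projProd u L x y = projProd u L x y := by
  induction L with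
  | nil => simp [projProd]
  | cons j L ih =>
    rw [projProd_cons, (h.commute_colProj_projProd j L x y y).symm.mul_mul_mul_comm,
      h.colProj_mul_self, ih]

lemma IsSkewOrth.colProj_mul_projProd (h : IsSkewOrth u) {j : I} {L : List I} (hj : j ∈ L)
    (x y : I → ℤˣ) :
    colProj u x y j * projProd u L x y = projProd u L x y := by
  induction L with
  | nil => simp at hj
  | cons l L ih =>
    rw [projProd_cons]
    rcases List.mem_cons.1 hj with rfl | hj
    · rw [← mul_assoc, h.colProj_mul_self]
    · rw [← mul_assoc, (h.commute_colProj j l x y y).eq, mul_assoc, ih hj]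

lemma IsSkewOrth.projProd_mul_of_ne (h : IsSkewOrth u) {j : I} {L : List I} (hj : j ∈ L)
    {y z : I → ℤˣ}
    (hyz : y j ≠ z j) (x : I → ℤˣ) : projProd u L x y * projProd u L x z = 0 := by
  rw [← h.colProj_mul_projProd hj x y, ← h.colProj_mul_projProd hj x z,
    (h.commute_colProj_projProd j L x y y).eq, mul_assoc, ← mul_assoc (colProj u x y j),
    h.colProj_mul_of_ne hyz, zero_mul, mul_zero]

lemma IsSkewOrth.colSum_mul_projProd (h : IsSkewOrth u) {j : I} {L : List I} (hj : j ∈ L)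
    (x y : I → ℤˣ) :
    colSum u j x * projProd u L x y = sgn (y j) • projProd u L x y := by
  rw [← h.colProj_mul_projProd hj x y, ← mul_assoc, h.colSum_mul_colProj, smul_mul_assoc]

/-- `mul_colSum_flip` applied to each factor; it needs the column `j` to be absent from `L`. -/
lemma IsSkewOrth.mul_projProd_flip (h : IsSkewOrth u) {i j : I} {L : List I} (hj : j ∉ L)
    (x y : I → ℤˣ) :
    u i j * projProd u L (flip x i) y = projProd u L x y * u i j := by
  induction L with
  | nil => simp [projProd]
  | cons l L ih =>
    rw [List.mem_cons, not_or] at hj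
    have h1 : u i j * colProj u (flip x i) y l = colProj u x y l * u i j := by
      rw [colProj, colProj, mul_smul_comm, mul_add, mul_smul_comm, h.mul_colSum_flip hj.1,
        smul_mul_assoc, add_mul, smul_mul_assoc, mul_one, one_mul]
    rw [projProd_cons, projProd_cons, ← mul_assoc, h1, mul_assoc, ih hj.2, mul_assoc]

/-- For `L` the list of all coordinates this is dv = vd. Partial products are used to allow an
induction: adding the factor `j` changes both sides by the same correction -y_j s_j(x) P_L(x, y). On
the left it is spread over all flips of `x`, on the right it comes from the single flip of y_j. -/
lemma IsSkewOrth.sum_projProd_flip (h : IsSkewOrth u) {L : List I} (hL : L.Nodup) (x y : I → ℤˣ) :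
    ∑ i, projProd u L (flip x i) y = ∑ i, projProd u L x (flip y i) := by
  induction L with
  | nil => simp [projProd]
  | cons j L ih =>
    obtain ⟨hj, hL⟩ := List.nodup_cons.1 hL
    have h1 : ∀ i, projProd u (j :: L) (flip x i) y =
        colProj u x y j * projProd u L (flip x i) y -
          sgn (y j) • (projProd u L x y * (sgn (x i) • u i j)) := fun i => by
      rw [projProd_cons, colProj_flip_left, sub_mul, smul_mul_assoc, h.mul_projProd_flip hj,
        mul_smul_comm, smul_smul]
    have h2 : ∀ i, projProd u (j :: L) x (flip y i) =
        colProj u x y j * projProd u L x (flip y i) -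
          if i = j then sgn (y j) • (colSum u j x * projProd u L x y) else 0 := fun i => by
      rw [projProd_cons]
      split_ifs with hi
      · subst hi
        rw [colProj_flip_right_self, sub_mul, smul_mul_assoc, projProd_flip_right u hj]
      · rw [colProj_flip_right_of_ne u (Ne.symm hi), sub_zero]
    simp only [h1, h2, Finset.sum_sub_distrib, ← Finset.mul_sum, ← Finset.smul_sum, ih hL,
      Finset.sum_ite_eq', Finset.mem_univ, if_true]
    rw [(h.commute_colSum_projProd j L x y).eq]
    rfl

/-- Pairing `y` with its flip at `j` adds up the two complementary projections of the factor `j`,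
which removes this factor and halves the sum. -/
lemma sum_projProd {L : List I} (hL : L.Nodup) (x : I → ℤˣ) :
    (2 ^ L.length : ℂ) • ∑ y, projProd u L x y = (2 ^ Fintype.card I : ℂ) • (1 : B) := by
  induction L with
  | nil =>
    simp only [projProd, List.map_nil, List.prod_nil, Finset.sum_const, Finset.card_univ,
      List.length_nil, pow_zero, one_smul]
    rw [← Nat.cast_smul_eq_nsmul ℂ]
    simp
  | cons j L ih =>
    obtain ⟨hj, hL⟩ := List.nodup_cons.1 hL
    rw [← ih hL, List.length_cons, pow_succ, mul_smul]
    congr 1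
    rw [two_smul]
    nth_rewrite 1 [← sum_flip j]
    rw [← Finset.sum_add_distrib]
    refine Finset.sum_congr rfl fun y _ => ?_
    rw [projProd_cons, projProd_cons, projProd_flip_right u hj, ← add_mul, colProj_flip_right_self]
    have h1 : colProj u x y j - sgn (y j) • colSum u j x + colProj u x y j = 1 := by
      rw [colProj]
      module
    rw [h1, one_mul]

variable [StarModule ℂ B]

lemma IsSkewOrth.star_colProj (h : IsSkewOrth u) (j : I) (x y : I → ℤˣ) :
    star (colProj u x y j) = colProj u x y j := by
  simp [colProj, colSum, star_sum, star_smul, star_sgn, h.real, -Complex.star_def]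

lemma IsSkewOrth.star_projProd (h : IsSkewOrth u) (L : List I) (x y : I → ℤˣ) :
    star (projProd u L x y) = projProd u L x y := by
  induction L with
  | nil => simp [projProd]
  | cons j L ih =>
    rw [projProd_cons, star_mul, ih, h.star_colProj, (h.commute_colProj_projProd j L x y y).eq]

end Ring

/-- The magic unitary matrix attached to a skew orthogonal matrix. -/
def cubeMatrix (u : Matrix I I B) : Matrix (I → ℤˣ) (I → ℤˣ) B :=
  Matrix.of fun x y => projProd u Finset.univ.toList x y

lemma cubeMatrix_apply (u : Matrix I I B) (x y : I → ℤˣ) :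
    cubeMatrix u x y = projProd u Finset.univ.toList x y := rfl

end SkewToMagic

/-- Projections in a C*-algebra that sum up to `1` are mutually orthogonal. -/
lemma mul_eq_zero_of_sum_eq_one {J : Type*} [Fintype J] [DecidableEq J] {B : Type*}
    [CStarAlgebra B] {p : J → B} (hs : ∀ i, star (p i) = p i) (hi : ∀ i, p i * p i = p i)
    (h1 : ∑ i, p i = 1) {i j : J} (hij : i ≠ j) : p i * p j = 0 := by
  let _ : PartialOrder B := CStarAlgebra.spectralOrder B
  have _ : StarOrderedRing B := CStarAlgebra.spectralOrderedRing B
  -- Compressing ∑ p_k = 1 by p_j leaves ∑ p_j p_k p_j = 0 over k ≠ j. The terms are positive by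
  -- this identity, so each of them vanishes.
  have e : ∀ k, p j * p k * p j = star (p k * p j) * (p k * p j) := fun k => by
    rw [star_mul, hs, hs, mul_assoc, mul_assoc, ← mul_assoc (p k), hi]
  have hsum : ∑ k, p j * p k * p j = p j := by
    rw [← Finset.sum_mul, ← Finset.mul_sum, h1, mul_one, hi]
  rw [← Finset.add_sum_erase _ _ (Finset.mem_univ j), hi, hi, add_eq_left,
    Finset.sum_eq_zero_iff_of_nonneg fun k _ => by rw [e]; exact star_mul_self_nonneg _] at hsum
  have h2 := hsum i (Finset.mem_erase.2 ⟨hij, Finset.mem_univ i⟩)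
  rw [e] at h2
  exact CStarRing.star_mul_self_eq_zero_iff _ |>.1 h2

/-! ### Row sums, column sums and the magic property -/

section SkewToMagicCStar

variable {B : Type*} [CStarAlgebra B]

lemma cubeMatrix_row_sum {I : Type*} [Fintype I] [DecidableEq I] (u : Matrix I I B)
    (x : I → ℤˣ) : ∑ y, cubeMatrix u x y = 1 := by
  have h1 := sum_projProd (u := u) (Finset.nodup_toList Finset.univ) x
  rw [Finset.length_toList, Finset.card_univ] at h1
  exact smul_right_injective B two_pow_ne_zero h1

/-- Commutation with the adjacency matrix makes the column sum a harmonic function of `y`, hence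
constant; the constant is read off from the total over all entries, which the row sums give. -/
lemma IsSkewOrth.cubeMatrix_col_sum {I : Type*} [Fintype I] [DecidableEq I] {u : Matrix I I B}
    (h : IsSkewOrth u) (y : I → ℤˣ) : ∑ x, cubeMatrix u x y = 1 := by
  have h1 : (2 ^ Fintype.card I : ℂ) • ∑ x, cubeMatrix u x y = ∑ z, ∑ x, cubeMatrix u x z := by
    refine smul_eq_sum_of_harmonic (F := fun y => ∑ x, cubeMatrix u x y) (fun y => ?_) y
    rw [Finset.sum_comm]
    simp only [cubeMatrix_apply, ← h.sum_projProd_flip (Finset.nodup_toList Finset.univ)]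
    rw [Finset.sum_comm]
    have h2 : ∀ i, ∑ x, projProd u Finset.univ.toList (flip x i) y =
        ∑ x, projProd u Finset.univ.toList x y := fun i => sum_flip i fun x => projProd u _ x y
    simp only [h2, Finset.sum_const, Finset.card_univ]
    rw [Nat.cast_smul_eq_nsmul ℂ]
  rw [Finset.sum_comm] at h1
  simp only [cubeMatrix_row_sum u, Finset.sum_const, Finset.card_univ] at h1
  rw [← Nat.cast_smul_eq_nsmul ℂ] at h1
  refine smul_right_injective B (two_pow_ne_zero (I := I)) (h1.trans ?_)
  simp

/-- A skew orthogonal matrix defines a magic unitary matrix that commutes with the adjacency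
matrix of the hypercube. -/
lemma IsSkewOrth.isGraphMagic_cubeMatrix {n : ℕ} {u : Matrix (Fin n) (Fin n) B}
    (h : IsSkewOrth u) : IsGraphMagic (hypercube n) (cubeMatrix u) where
  selfAdjoint x y := h.star_projProd _ x y
  idempotent x y := h.projProd_mul_self _ x y
  row_orth x y z hyz := by
    obtain ⟨j, hj⟩ := Function.ne_iff.1 hyz
    exact h.projProd_mul_of_ne (Finset.mem_toList.2 (Finset.mem_univ j)) hj x
  -- Projections in different rows belong to non-commuting families, so orthogonality is deduced
  -- from positivity and not from an algebraic identity.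
  col_orth y x z hxz := mul_eq_zero_of_sum_eq_one (p := fun x => cubeMatrix u x y)
    (fun x => h.star_projProd _ x y) (fun x => h.projProd_mul_self _ x y)
    (h.cubeMatrix_col_sum y) hxz
  row_sum x := cubeMatrix_row_sum u x
  col_sum y := h.cubeMatrix_col_sum y
  graph := by
    ext x y
    rw [hypercube_adjMatrix_mul, mul_hypercube_adjMatrix]
    exact h.sum_projProd_flip (Finset.nodup_toList Finset.univ) x y

end SkewToMagicCStar

/-! ### From magic unitaries to skew orthogonal matrices -/

section MagicToSkew

variable {I : Type*} [Fintype I] [DecidableEq I] {B : Type*} [Ring B] [StarRing B] [Algebra ℂ B]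

/-- The compression of a matrix indexed by the hypercube to the linear functions. -/
def linPart (v : Matrix (I → ℤˣ) (I → ℤˣ) B) : Matrix I I B :=
  Matrix.of fun i j => ((2 : ℂ) ^ Fintype.card I)⁻¹ • ∑ x, ∑ y, (sgn (x i) * sgn (y j)) • v x y

lemma linPart_apply (v : Matrix (I → ℤˣ) (I → ℤˣ) B) (i j : I) :
    linPart v i j =
      ((2 : ℂ) ^ Fintype.card I)⁻¹ • ∑ x, ∑ y, (sgn (x i) * sgn (y j)) • v x y := rfl

lemma linPart_transpose (v : Matrix (I → ℤˣ) (I → ℤˣ) B) :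
    linPart v.transpose = (linPart v).transpose := by
  ext i j
  rw [Matrix.transpose_apply, linPart_apply, linPart_apply, Finset.sum_comm]
  exact congrArg _ (Finset.sum_congr rfl fun x _ => Finset.sum_congr rfl fun y _ => by
    rw [Matrix.transpose_apply, mul_comm])

/-- The action of `v` on the `j`-th coordinate function. -/
def rowSum (v : Matrix (I → ℤˣ) (I → ℤˣ) B) (j : I) (x : I → ℤˣ) : B := ∑ y, sgn (y j) • v x y

lemma linPart_eq_sum_rowSum (v : Matrix (I → ℤˣ) (I → ℤˣ) B) (i j : I) :
    linPart v i j = ((2 : ℂ) ^ Fintype.card I)⁻¹ • ∑ x, sgn (x i) • rowSum v j x := by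
  simp only [linPart_apply, rowSum, Finset.smul_sum, smul_smul]

lemma sum_sgn_flip (y : I → ℤˣ) (j : I) :
    ∑ i, sgn (flip y i j) = ((Fintype.card I : ℂ) - 2) * sgn (y j) := by
  have := sum_chi_flip {j} y
  simpa [chi] using this

/-- As `v` commutes with the adjacency matrix, it sends the `j`-th coordinate function to an
eigenvector for the same eigenvalue n - 2. This is a linear function of `x`, whose coefficients are
by definition the entries of `linPart v`. -/
lemma rowSum_eq_colSum {v : Matrix (I → ℤˣ) (I → ℤˣ) B}
    (hv : ∀ x y, ∑ i, v (flip x i) y = ∑ i, v x (flip y i)) (j : I) (x : I → ℤˣ) :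
    rowSum v j x = colSum (linPart v) j x := by
  have h1 := smul_eq_sum_of_linear (F := rowSum v j) (fun x => by
    simp only [rowSum]
    rw [Finset.sum_comm]
    simp only [← Finset.smul_sum, hv]
    simp only [Finset.smul_sum]
    rw [Finset.sum_comm]
    have h2 : ∀ i, ∑ y, sgn (y j) • v x (flip y i) = ∑ y, sgn (flip y i j) • v x y := fun i => by
      rw [← sum_flip i]
      simp only [flip_flip]
    simp only [h2]
    rw [Finset.sum_comm]
    simp only [← Finset.sum_smul, sum_sgn_flip, smul_smul]) x
  refine smul_right_injective B (two_pow_ne_zero (I := I)) (h1.trans ?_)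
  simp only [colSum, linPart_eq_sum_rowSum]
  rw [Finset.smul_sum]
  refine Finset.sum_congr rfl fun i _ => ?_
  rw [smul_comm (sgn (x i)) (((2 : ℂ) ^ Fintype.card I)⁻¹), smul_smul,
    mul_inv_cancel₀ two_pow_ne_zero, one_smul]

/-- Orthogonality along the row makes f ↦ ∑_y f(y) v_xy multiplicative. The right-hand side is
visibly symmetric in `j` and `l`. -/
lemma IsMagic.rowSum_mul_rowSum {v : Matrix (I → ℤˣ) (I → ℤˣ) B} (h : IsMagic v) (j l : I)
    (x : I → ℤˣ) : rowSum v j x * rowSum v l x = ∑ y, (sgn (y j) * sgn (y l)) • v x y := by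
  rw [rowSum, rowSum, Finset.sum_mul]
  refine Finset.sum_congr rfl fun y _ => ?_
  simp only [Finset.mul_sum, smul_mul_smul_comm, h.row_mul, smul_ite, smul_zero, Finset.sum_ite_eq,
    Finset.mem_univ, if_true]

lemma sum_colSum_mul_colSum (u : Matrix I I B) (j l : I) :
    ∑ x, colSum u j x * colSum u l x = ((2 : ℂ) ^ Fintype.card I) • ∑ i, u i j * u i l := by
  simp only [colSum, Finset.sum_mul, Finset.mul_sum, smul_mul_smul_comm]
  rw [Finset.sum_comm, Finset.smul_sum]
  refine Finset.sum_congr rfl fun i _ => ?_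
  rw [Finset.sum_comm]
  simp only [← Finset.sum_smul, sum_sgn_mul_sgn, ite_smul, zero_smul, Finset.sum_ite_eq',
    Finset.mem_univ, if_true]

/-- The second difference of a product of linear functions. -/
lemma second_difference (u : Matrix I I B) (j l : I) {p q : I} (hpq : p ≠ q) :
    colSum u j 1 * colSum u l 1 - colSum u j (flip 1 p) * colSum u l (flip 1 p) -
        colSum u j (flip 1 q) * colSum u l (flip 1 q) +
        colSum u j (flip (flip 1 p) q) * colSum u l (flip (flip 1 p) q) =
      (4 : ℂ) • (u p j * u q l + u q j * u p l) := by
  -- The base point `1` has all signs positive, so a flip at `p` subtracts exactly 2 u_pj; the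
  -- second difference keeps only the mixed terms.
  have e1 : sgn 1 = 1 := by simp [sgn]
  simp only [colSum_flip, flip_of_ne _ hpq.symm, Pi.one_apply, e1, mul_one]
  have e4 : (4 : ℂ) • (u p j * u q l + u q j * u p l) =
      ((2 : ℂ) • u p j) * ((2 : ℂ) • u q l) + ((2 : ℂ) • u q j) * ((2 : ℂ) • u p l) := by
    rw [smul_mul_smul_comm, smul_mul_smul_comm, smul_add]
    norm_num
  rw [e4]
  generalize (2 : ℂ) • u p j = a, (2 : ℂ) • u q l = b, (2 : ℂ) • u q j = c, (2 : ℂ) • u p l = d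
  noncomm_ring

/-- The relations satisfied by the columns of the linear part. -/
structure IsColSkew (u : Matrix I I B) : Prop where
  transpose_mul : u.transpose * u = 1
  col : ∀ i j k, j ≠ k → u j i * u k i = -(u k i * u j i)
  exch : ∀ i j k l, i ≠ k →
    u i j * u k l + u k j * u i l = u i l * u k j + u k l * u i j

lemma IsMagic.isColSkew_linPart {v : Matrix (I → ℤˣ) (I → ℤˣ) B} (h : IsMagic v)
    (hv : ∀ x y, ∑ i, v (flip x i) y = ∑ i, v x (flip y i)) : IsColSkew (linPart v) := by
  have hprod : ∀ j l x, colSum (linPart v) j x * colSum (linPart v) l x =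
      ∑ y, (sgn (y j) * sgn (y l)) • v x y := fun j l x => by
    rw [← rowSum_eq_colSum hv, ← rowSum_eq_colSum hv, h.rowSum_mul_rowSum]
  have hsq : ∀ j x, colSum (linPart v) j x * colSum (linPart v) j x = 1 := fun j x => by
    simp only [hprod, sgn_mul_self, one_smul, h.row_sum]
  have hcomm : ∀ j l x, colSum (linPart v) j x * colSum (linPart v) l x =
      colSum (linPart v) l x * colSum (linPart v) j x := fun j l x => by
    rw [hprod, hprod]
    exact Finset.sum_congr rfl fun y _ => by rw [mul_comm]
  refine ⟨?_, fun j p q hpq => ?_, fun p j q l hpq => ?_⟩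
  · ext j l
    -- The products s_j(x) s_l(x) are summed over `x` in two ways: by orthogonality of the
    -- coordinate functions in `x`, and by the column sums of `v`.
    have h1 := sum_colSum_mul_colSum (linPart v) j l
    simp only [hprod] at h1
    rw [Finset.sum_comm] at h1
    simp only [← Finset.smul_sum, h.col_sum, ← Finset.sum_smul, sum_sgn_mul_sgn] at h1
    rw [Matrix.mul_apply, Matrix.one_apply]
    refine smul_right_injective B (two_pow_ne_zero (I := I)) (h1.symm.trans ?_)
    split_ifs <;> simp
  -- s_j(x)² is constant in `x`, so its second difference is zero.
  · have h1 := second_difference (linPart v) j j hpq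
    simp only [hsq] at h1
    refine eq_neg_of_add_eq_zero_left
      (smul_right_injective B (show (4 : ℂ) ≠ 0 by norm_num) (h1.symm.trans ?_))
    simp
  -- Second differences of s_j(x) s_l(x) and of s_l(x) s_j(x) agree.
  · have h1 := second_difference (linPart v) j l hpq
    rw [hcomm j l 1, hcomm j l (flip 1 p), hcomm j l (flip 1 q), hcomm j l (flip (flip 1 p) q),
      second_difference (linPart v) l j hpq] at h1
    exact (smul_right_injective B (show (4 : ℂ) ≠ 0 by norm_num) h1).symm

lemma star_linPart [StarModule ℂ B] {v : Matrix (I → ℤˣ) (I → ℤˣ) B}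
    (hv : ∀ x y, star (v x y) = v x y) (i j : I) : star (linPart v i j) = linPart v i j := by
  rw [linPart_apply, star_smul, star_sum]
  simp only [star_sum, star_smul, star_mul', star_sgn, hv]
  simp

/-- The linear part of a magic unitary matrix that commutes with the adjacency matrix of the
hypercube is skew orthogonal. -/
lemma IsMagic.isSkewOrth_linPart [StarModule ℂ B] {v : Matrix (I → ℤˣ) (I → ℤˣ) B}
    (h : IsMagic v) (hv : ∀ x y, ∑ i, v (flip x i) y = ∑ i, v x (flip y i)) :
    IsSkewOrth (linPart v) := by
  have h1 := h.isColSkew_linPart hv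
  -- Both the magic condition and the commutation are symmetric under transposition, so the column
  -- relations also hold for rows.
  have h2 := h.transpose.isColSkew_linPart fun x y => (hv y x).symm
  rw [linPart_transpose] at h2
  refine ⟨star_linPart h.selfAdjoint, ?_, h1.transpose_mul, fun i j k hjk => ?_, h1.col,
    fun i j k l hik hjl => ?_⟩
  · simpa using h2.transpose_mul
  · exact h2.col i j k hjk
  -- The exchange relation for columns reads [u_ij, u_kl] = [u_il, u_kj], the one for rows [u_ij,
  -- u_kl] = -[u_il, u_kj]. Their sum is 2 [u_ij, u_kl] = 0.
  · have e1 := h1.exch i j k l hik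
    have e2 := h2.exch j i l k hjl
    simp only [Matrix.transpose_apply] at e2
    refine smul_right_injective B (two_ne_zero (α := ℂ)) ?_
    simp only [two_smul]
    rw [← sub_eq_zero] at e1 e2 ⊢
    rw [← add_zero (0 : B)]
    nth_rewrite 1 [← e1]
    rw [← e2]
    abel

/-! ### The two constructions are inverse to each other -/

lemma sum_sgn_smul_colSum (u : Matrix I I B) (i j : I) :
    ∑ x, sgn (x i) • colSum u j x = ((2 : ℂ) ^ Fintype.card I) • u i j := by
  simp only [colSum, Finset.smul_sum, smul_smul]
  rw [Finset.sum_comm]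
  simp only [← Finset.sum_smul, sum_sgn_mul_sgn, ite_smul, zero_smul, Finset.sum_ite_eq,
    Finset.mem_univ, if_true]

/-- Each factor is the sum of the v_xz with z_j = y_j, and products of such partial row sums
correspond to intersections of the index sets. With all coordinates in `L`, only z = y remains. -/
lemma IsMagic.projProd_linPart {v : Matrix (I → ℤˣ) (I → ℤˣ) B} (h : IsMagic v)
    (hv : ∀ x y, ∑ i, v (flip x i) y = ∑ i, v x (flip y i)) (L : List I) (x y : I → ℤˣ) :
    projProd (linPart v) L x y = ∑ z, if ∀ j ∈ L, z j = y j then v x z else 0 := by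
  induction L with
  | nil => simp [projProd, h.row_sum]
  | cons j L ih =>
    have h1 : colProj (linPart v) x y j = ∑ z, if z j = y j then v x z else 0 := by
      rw [colProj, ← rowSum_eq_colSum hv, rowSum, ← h.row_sum x, Finset.smul_sum,
        ← Finset.sum_add_distrib, Finset.smul_sum]
      refine Finset.sum_congr rfl fun z _ => ?_
      split_ifs with hz
      · rw [hz, smul_smul, sgn_mul_self]
        module
      · rw [sgn_ne (Ne.symm hz), smul_smul, mul_neg, sgn_mul_self]
        module
    rw [projProd_cons, ih, h1, Finset.sum_mul]
    refine Finset.sum_congr rfl fun z _ => ?_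
    rw [Finset.mul_sum, Finset.sum_eq_single z]
    · simp only [List.forall_mem_cons (p := fun l => z l = y l)]
      by_cases hz : z j = y j
      · by_cases hz' : ∀ l ∈ L, z l = y l
        · rw [if_pos hz, if_pos hz', if_pos ⟨hz, hz'⟩, h.idempotent]
        · rw [if_neg hz', mul_zero, if_neg fun h' => hz' h'.2]
      · rw [if_neg hz, zero_mul, if_neg fun h' => hz h'.1]
    · intro w _ hw
      split_ifs <;> simp [h.row_orth x z w hw.symm]
    · simp

lemma IsMagic.cubeMatrix_linPart {v : Matrix (I → ℤˣ) (I → ℤˣ) B} (h : IsMagic v)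
    (hv : ∀ x y, ∑ i, v (flip x i) y = ∑ i, v x (flip y i)) : cubeMatrix (linPart v) = v := by
  ext x y
  simp [cubeMatrix_apply, h.projProd_linPart hv, ← funext_iff]

end MagicToSkew

lemma IsSkewOrth.linPart_cubeMatrix {I : Type*} [Fintype I] [DecidableEq I] {B : Type*}
    [CStarAlgebra B] {u : Matrix I I B} (h : IsSkewOrth u) : linPart (cubeMatrix u) = u := by
  ext i j
  -- Spectral decomposition: s_j(x) acts on the projection of index `y` as the scalar y_j, and the
  -- projections sum up to 1.
  have h1 : ∀ x, rowSum (cubeMatrix u) j x = colSum u j x := fun x => by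
    rw [← mul_one (colSum u j x), ← cubeMatrix_row_sum u x, Finset.mul_sum, rowSum]
    refine Finset.sum_congr rfl fun y _ => ?_
    rw [cubeMatrix_apply, h.colSum_mul_projProd (Finset.mem_toList.2 (Finset.mem_univ j))]
  rw [linPart_eq_sum_rowSum]
  simp only [h1]
  rw [sum_sgn_smul_colSum, smul_smul, inv_mul_cancel₀ two_pow_ne_zero, one_smul]

lemma IsGraphMagic.sum_flip {n : ℕ} {B : Type*} [Ring B] [StarRing B]
    {v : Matrix (Fin n → ℤˣ) (Fin n → ℤˣ) B} (h : IsGraphMagic (hypercube n) v)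
    (x y : Fin n → ℤˣ) : ∑ i, v (flip x i) y = ∑ i, v x (flip y i) := by
  rw [← hypercube_adjMatrix_mul, h.graph, mul_hypercube_adjMatrix]

/-! ### Elementary tensors -/

section Tensor

variable {A : Type*} [CStarAlgebra A]

lemma ctmul_mul_ctmul (a b c d : A) : ctmul a b * ctmul c d = ctmul (a * c) (b * d) := by
  rw [ctmul, ctmul, ← map_mul, Algebra.TensorProduct.tmul_mul_tmul, ctmul]

lemma star_ctmul (a b : A) : star (ctmul a b) = ctmul (star a) (star b) := by
  rw [ctmul, ← map_star, TensorProduct.star_tmul, ctmul]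

lemma ctmul_one_one : ctmul (1 : A) (1 : A) = 1 := by
  rw [ctmul, ← Algebra.TensorProduct.one_def, map_one]

lemma ctmul_sum {J : Type*} (s : Finset J) (a : A) (b : J → A) :
    ctmul a (∑ j ∈ s, b j) = ∑ j ∈ s, ctmul a (b j) := by
  simp only [ctmul, TensorProduct.tmul_sum, map_sum]

lemma sum_ctmul {J : Type*} (s : Finset J) (a : J → A) (b : A) :
    ctmul (∑ j ∈ s, a j) b = ∑ j ∈ s, ctmul (a j) b := by
  simp only [ctmul, TensorProduct.sum_tmul, map_sum]

lemma ctmul_zero (a : A) : ctmul a (0 : A) = 0 := by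
  rw [ctmul, TensorProduct.tmul_zero, map_zero]

lemma zero_ctmul (b : A) : ctmul (0 : A) b = 0 := by
  rw [ctmul, TensorProduct.zero_tmul, map_zero]

lemma ctmul_neg (a b : A) : ctmul a (-b) = -ctmul a b := by
  rw [ctmul, TensorProduct.tmul_neg, map_neg, ctmul]

lemma neg_ctmul (a b : A) : ctmul (-a) b = -ctmul a b := by
  rw [ctmul, TensorProduct.neg_tmul, map_neg, ctmul]

variable (A) in
/-- The morphism `a ↦ a ⊗ 1`. -/
def leftHom : A →⋆ₐ[ℂ] CTensor A A := (UnivCStar.mk (NoRel (A ⊗[ℂ] A))).comp (inclLeft A A)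

variable (A) in
/-- The morphism `a ↦ 1 ⊗ a`. -/
def rightHom : A →⋆ₐ[ℂ] CTensor A A := (UnivCStar.mk (NoRel (A ⊗[ℂ] A))).comp (inclRight A A)

lemma leftHom_apply (a : A) : leftHom A a = ctmul a 1 := rfl

lemma rightHom_apply (a : A) : rightHom A a = ctmul 1 a := rfl

variable {I : Type*} [Fintype I] [DecidableEq I]

/-- The matrix with entries `∑ₖ uᵢₖ ⊗ uₖⱼ`. -/
def comulMatrix (u : Matrix I I A) : Matrix I I (CTensor A A) :=
  Matrix.of fun i j => ∑ k, ctmul (u i k) (u k j)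

lemma comulMatrix_apply (u : Matrix I I A) (i j : I) :
    comulMatrix u i j = ∑ k, ctmul (u i k) (u k j) := rfl

/-- Writing the comultiplication as a matrix product lets `linPart_mul` and the commutation with
adjacency matrices apply to it. -/
lemma comulMatrix_eq_mul (u : Matrix I I A) :
    comulMatrix u = u.map (leftHom A) * u.map (rightHom A) := by
  ext i j
  rw [comulMatrix_apply, Matrix.mul_apply]
  refine Finset.sum_congr rfl fun k _ => ?_
  rw [map_matrix_apply, map_matrix_apply, leftHom_apply, rightHom_apply, ctmul_mul_ctmul, mul_one,
    one_mul]

lemma comulMatrix_mul (u : Matrix I I A) (i j k l : I) :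
    comulMatrix u i j * comulMatrix u k l =
      ∑ a, ∑ b, ctmul (u i a * u k b) (u a j * u b l) := by
  simp only [comulMatrix_apply, Finset.sum_mul, Finset.mul_sum, ctmul_mul_ctmul]
  exact Finset.sum_comm

lemma ctmul_ite_one (p : Prop) [Decidable p] :
    ctmul (if p then (1 : A) else 0) (1 : A) = if p then 1 else 0 := by
  split_ifs
  · exact ctmul_one_one
  · exact zero_ctmul 1

lemma one_ctmul_ite (p : Prop) [Decidable p] :
    ctmul (1 : A) (if p then (1 : A) else 0) = if p then 1 else 0 := by
  split_ifs
  · exact ctmul_one_one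
  · exact ctmul_zero 1

lemma ctmul_ite (a b : A) (p : Prop) [Decidable p] :
    ctmul a (if p then b else 0) = if p then ctmul a b else 0 := by
  split_ifs
  · rfl
  · exact ctmul_zero a

lemma ite_ctmul (a b : A) (p : Prop) [Decidable p] :
    ctmul (if p then a else 0) b = if p then ctmul a b else 0 := by
  split_ifs
  · rfl
  · exact zero_ctmul b

/-- The skew relations are checked term by term in the double sum over `a`, `b`. For rows and
columns exactly one tensor leg changes sign, which one depending on whether a = b; in `comm` both
legs change sign when a = b and none otherwise. -/
lemma IsSkewOrth.comul {u : Matrix I I A} (h : IsSkewOrth u) :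
    IsSkewOrth (comulMatrix u) where
  real i j := by simp only [comulMatrix_apply, star_sum, star_ctmul, h.real]
  mul_transpose := by
    ext i k
    simp only [Matrix.mul_apply, Matrix.transpose_apply, comulMatrix_mul, Matrix.one_apply]
    rw [Finset.sum_comm]
    have h1 : ∀ a, ∑ j, ∑ b, ctmul (u i a * u k b) (u a j * u b j) = ctmul (u i a * u k a) 1 :=
      fun a => by
        rw [Finset.sum_comm]
        simp only [← ctmul_sum, h.row_mul_row, ctmul_ite, Finset.sum_ite_eq, Finset.mem_univ,
          if_true]
    simp only [h1, ← sum_ctmul, h.row_mul_row, ctmul_ite_one]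
  transpose_mul := by
    ext j l
    simp only [Matrix.mul_apply, Matrix.transpose_apply, comulMatrix_mul, Matrix.one_apply]
    rw [Finset.sum_comm]
    have h1 : ∀ a, ∑ i, ∑ b, ctmul (u i a * u i b) (u a j * u b l) = ctmul 1 (u a j * u a l) :=
      fun a => by
        rw [Finset.sum_comm]
        simp only [← sum_ctmul, h.col_mul_col, ite_ctmul, Finset.sum_ite_eq, Finset.mem_univ,
          if_true]
    simp only [h1, ← ctmul_sum, h.col_mul_col, one_ctmul_ite]
  row i j k hjk := by
    rw [comulMatrix_mul, comulMatrix_mul, Finset.sum_comm, ← Finset.sum_neg_distrib]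
    refine Finset.sum_congr rfl fun b _ => ?_
    rw [← Finset.sum_neg_distrib]
    refine Finset.sum_congr rfl fun a _ => ?_
    by_cases hab : a = b
    · subst hab
      rw [h.row a j k hjk, ctmul_neg]
    · rw [h.row i a b hab, h.comm a j b k hab hjk, neg_ctmul]
  col i j k hjk := by
    rw [comulMatrix_mul, comulMatrix_mul, Finset.sum_comm, ← Finset.sum_neg_distrib]
    refine Finset.sum_congr rfl fun b _ => ?_
    rw [← Finset.sum_neg_distrib]
    refine Finset.sum_congr rfl fun a _ => ?_
    by_cases hab : a = b
    · subst hab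
      rw [h.col a j k hjk, neg_ctmul]
    · rw [h.col i a b hab, h.comm j a k b hjk hab, ctmul_neg]
  comm i j k l hik hjl := by
    rw [comulMatrix_mul, comulMatrix_mul, Finset.sum_comm]
    refine Finset.sum_congr rfl fun b _ => ?_
    refine Finset.sum_congr rfl fun a _ => ?_
    by_cases hab : a = b
    · subst hab
      rw [h.col a i k hik, h.row a j l hjl, neg_ctmul, ctmul_neg, neg_neg]
    · rw [h.comm i a k b hik hab, h.comm a j b l hab hjl]

lemma IsMagic.comul {v : Matrix I I A} (h : IsMagic v) : IsMagic (comulMatrix v) := by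
  have row : ∀ i j k, comulMatrix v i j * comulMatrix v i k =
      if j = k then comulMatrix v i j else 0 := fun i j k => by
    rw [comulMatrix_mul]
    simp only [h.row_mul, ite_ctmul, Finset.sum_ite_eq, Finset.mem_univ, if_true,
      ctmul_ite, comulMatrix_apply]
    split_ifs <;> simp
  have col : ∀ i j k, comulMatrix v j i * comulMatrix v k i =
      if j = k then comulMatrix v j i else 0 := fun i j k => by
    rw [comulMatrix_mul]
    simp only [h.col_mul, ctmul_ite, Finset.sum_ite_eq, Finset.mem_univ, if_true,
      ite_ctmul, comulMatrix_apply]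
    split_ifs <;> simp
  refine ⟨fun i j => ?_, fun i j => ?_, fun i j k hjk => ?_, fun i j k hjk => ?_, fun i => ?_,
    fun i => ?_⟩
  · simp only [comulMatrix_apply, star_sum, star_ctmul, h.selfAdjoint]
  · rw [row, if_pos rfl]
  · rw [row, if_neg hjk]
  · rw [col, if_neg hjk]
  · simp only [comulMatrix_apply]
    rw [Finset.sum_comm]
    simp only [← ctmul_sum, ← sum_ctmul, h.row_sum, ctmul_one_one]
  · simp only [comulMatrix_apply]
    rw [Finset.sum_comm]
    simp only [← ctmul_sum, ← sum_ctmul, h.col_sum, ctmul_one_one]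

lemma IsGraphMagic.map {B : Type*} [CStarAlgebra B] {G : SimpleGraph I} [DecidableRel G.Adj]
    {v : Matrix I I A} (h : IsGraphMagic G v) (f : A →⋆ₐ[ℂ] B) : IsGraphMagic G (v.map f) where
  toIsMagic := h.toIsMagic.map f
  graph := by
    ext i j
    have h1 := congrArg f (congrFun (congrFun h.graph i) j)
    simp only [Matrix.mul_apply, map_sum, map_mul, map_adjMatrix_apply] at h1
    simp only [Matrix.mul_apply]
    exact h1

lemma IsGraphMagic.comul {G : SimpleGraph I} [DecidableRel G.Adj] {v : Matrix I I A}
    (h : IsGraphMagic G v) : IsGraphMagic G (comulMatrix v) where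
  toIsMagic := h.toIsMagic.comul
  graph := by
    rw [comulMatrix_eq_mul, ← Matrix.mul_assoc, (h.map _).graph, Matrix.mul_assoc, (h.map _).graph,
      Matrix.mul_assoc]

end Tensor

/-! ### Opposite and identity matrices -/

section Antipode

variable {I : Type*} [Fintype I] [DecidableEq I]

/-- The transpose of a matrix, with entries in the opposite algebra. -/
def opMatrix {A : Type*} (u : Matrix I I A) : Matrix I I Aᵐᵒᵖ :=
  Matrix.of fun i j => MulOpposite.op (u j i)

lemma opMatrix_apply {A : Type*} (u : Matrix I I A) (i j : I) :
    opMatrix u i j = MulOpposite.op (u j i) := rfl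

variable {A : Type*} [Ring A] [StarRing A]

/-- Transposition exchanges the row and column relations, which have the same form, and reversing
products preserves commutation and anticommutation. -/
lemma IsSkewOrth.op {u : Matrix I I A} (h : IsSkewOrth u) : IsSkewOrth (opMatrix u) where
  real i j := by rw [opMatrix_apply, ← MulOpposite.op_star, h.real]
  mul_transpose := by
    ext i k
    simp only [Matrix.mul_apply, Matrix.transpose_apply, opMatrix_apply, ← MulOpposite.op_mul,
      ← Finset.op_sum, h.col_mul_col, Matrix.one_apply]
    split_ifs <;> simp_all
  transpose_mul := by
    ext i k
    simp only [Matrix.mul_apply, Matrix.transpose_apply, opMatrix_apply, ← MulOpposite.op_mul,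
      ← Finset.op_sum, h.row_mul_row, Matrix.one_apply]
    split_ifs <;> simp_all
  row i j k hjk := by
    simp only [opMatrix_apply, ← MulOpposite.op_mul, ← MulOpposite.op_neg]
    rw [h.col i k j hjk.symm]
  col i j k hjk := by
    simp only [opMatrix_apply, ← MulOpposite.op_mul, ← MulOpposite.op_neg]
    rw [h.row i k j hjk.symm]
  comm i j k l hik hjl := by
    simp only [opMatrix_apply, ← MulOpposite.op_mul]
    rw [h.comm j i l k hjl hik]

lemma IsGraphMagic.op {G : SimpleGraph I} [DecidableRel G.Adj] {v : Matrix I I A}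
    (h : IsGraphMagic G v) : IsGraphMagic G (opMatrix v) where
  selfAdjoint i j := by rw [opMatrix_apply, ← MulOpposite.op_star, h.selfAdjoint]
  idempotent i j := by rw [opMatrix_apply, ← MulOpposite.op_mul, h.idempotent]
  row_orth i j k hjk := by
    rw [opMatrix_apply, opMatrix_apply, ← MulOpposite.op_mul, h.col_orth i k j hjk.symm,
      MulOpposite.op_zero]
  col_orth i j k hjk := by
    rw [opMatrix_apply, opMatrix_apply, ← MulOpposite.op_mul, h.row_orth i k j hjk.symm,
      MulOpposite.op_zero]
  row_sum i := by simp only [opMatrix_apply, ← Finset.op_sum, h.col_sum, MulOpposite.op_one]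
  col_sum i := by simp only [opMatrix_apply, ← Finset.op_sum, h.row_sum, MulOpposite.op_one]
  graph := by
    ext i j
    -- Transposing dv = vd exchanges its two sides, since the adjacency matrix is symmetric with
    -- scalar entries.
    have h1 := congrArg MulOpposite.op (congrFun (congrFun h.graph j) i)
    simp only [Matrix.mul_apply, SimpleGraph.adjMatrix_apply, mul_ite, ite_mul, one_mul, mul_one,
      zero_mul, mul_zero, Finset.op_sum, apply_ite MulOpposite.op, MulOpposite.op_zero] at h1
    simp only [Matrix.mul_apply, SimpleGraph.adjMatrix_apply, mul_ite, ite_mul, one_mul, mul_one,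
      zero_mul, mul_zero, opMatrix_apply, G.adj_comm i, G.adj_comm _ j]
    exact h1.symm

variable (I) in
lemma isSkewOrth_one : IsSkewOrth (1 : Matrix I I ℂ) where
  real i j := by rw [Matrix.one_apply]; split_ifs <;> simp
  mul_transpose := by simp
  transpose_mul := by simp
  row i j k hjk := by
    simp only [Matrix.one_apply]
    split_ifs <;> simp_all
  col i j k hjk := by
    simp only [Matrix.one_apply]
    split_ifs <;> simp_all
  comm i j k l _ _ := mul_comm _ _

lemma isGraphMagic_one (G : SimpleGraph I) [DecidableRel G.Adj] :
    IsGraphMagic G (1 : Matrix I I ℂ) where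
  selfAdjoint i j := by rw [Matrix.one_apply]; split_ifs <;> simp
  idempotent i j := by rw [Matrix.one_apply]; split_ifs <;> simp
  row_orth i j k hjk := by
    simp only [Matrix.one_apply]
    split_ifs <;> simp_all
  col_orth i j k hjk := by
    simp only [Matrix.one_apply]
    split_ifs <;> simp_all
  row_sum i := by simp [Matrix.one_apply]
  col_sum i := by simp [Matrix.one_apply]
  graph := by rw [mul_one, one_mul]

end Antipode

/-! ### The Hopf algebra structures -/

section Hopf

variable (I : Type*) [Fintype I] [DecidableEq I]

lemma star_eq_transpose {A : Type*} [Star A] {u : Matrix I I A} (h : ∀ i j, star (u i j) = u i j) :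
    star u = u.transpose := by
  ext i j
  exact h j i

lemma IsMagic.mul_transpose {A : Type*} [Ring A] [StarRing A] {I : Type*} [Fintype I]
    [DecidableEq I] {v : Matrix I I A} (h : IsMagic v) : v * v.transpose = 1 := by
  ext i j
  simp only [Matrix.mul_apply, Matrix.transpose_apply, h.col_mul, Matrix.one_apply]
  split_ifs
  · exact h.row_sum i
  · exact Finset.sum_const_zero

/-- The Hopf algebra structure of `C(O_n^{-1})`. -/
def COneg.hopf : FGHopf (COneg I) (COneg.u I) where
  unitary_mem := by
    have h := COneg.isSkewOrth_u I
    rw [Unitary.mem_iff, star_eq_transpose I h.real]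
    exact ⟨h.transpose_mul, h.mul_transpose⟩
  dense := COneg.dense I
  comul := COneg.lift _ (COneg.isSkewOrth_u I).comul
  counit := COneg.lift _ (isSkewOrth_one I)
  antipode := COneg.lift _ (COneg.isSkewOrth_u I).op
  comul_apply i j := COneg.lift_u _ _ i j
  counit_apply i j := COneg.lift_u _ _ i j
  antipode_apply i j := by
    rw [COneg.lift_u, opMatrix_apply, (COneg.isSkewOrth_u I).real]

variable {I}

/-- The Hopf algebra structure of the quantum symmetry algebra of a graph. -/
def QSym.hopf (G : SimpleGraph I) [DecidableRel G.Adj] : FGHopf (QSym G) (QSym.u G) where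
  unitary_mem := by
    have h := (QSym.isGraphMagic_u G).toIsMagic
    rw [Unitary.mem_iff, star_eq_transpose I h.selfAdjoint]
    exact ⟨h.transpose.mul_transpose, h.mul_transpose⟩
  dense := QSym.dense G
  comul := QSym.lift _ (QSym.isGraphMagic_u G).comul
  counit := QSym.lift _ (isGraphMagic_one G)
  antipode := QSym.lift _ (QSym.isGraphMagic_u G).op
  comul_apply i j := QSym.lift_u _ _ i j
  counit_apply i j := QSym.lift_u _ _ i j
  antipode_apply i j := by
    rw [QSym.lift_u, opMatrix_apply, (QSym.isGraphMagic_u G).selfAdjoint]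

lemma map_QSym_u {G : SimpleGraph I} [DecidableRel G.Adj] {B : Type*} [CStarAlgebra B]
    (w : Matrix I I B) (h : IsGraphMagic G w) : (QSym.u G).map (QSym.lift w h) = w := by
  ext i j
  exact QSym.lift_u w h i j

lemma map_COneg_u {B : Type*} [CStarAlgebra B] (w : Matrix I I B) (h : IsSkewOrth w) :
    (COneg.u I).map (COneg.lift w h) = w := by
  ext i j
  exact COneg.lift_u w h i j

end Hopf

/-! ### The isomorphism -/

section Iso

variable {I : Type*} [Fintype I] [DecidableEq I] {A B : Type*} [CStarAlgebra A] [CStarAlgebra B]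

lemma map_linPart (f : A →⋆ₐ[ℂ] B) (v : Matrix (I → ℤˣ) (I → ℤˣ) A) (i j : I) :
    f (linPart v i j) = linPart (v.map f) i j := by
  simp only [linPart_apply, map_smul, map_sum, map_matrix_apply]

lemma map_cubeMatrix (f : A →⋆ₐ[ℂ] B) (u : Matrix I I A) (x y : I → ℤˣ) :
    f (cubeMatrix u x y) = cubeMatrix (u.map f) x y := by
  rw [cubeMatrix_apply, cubeMatrix_apply, projProd, projProd, map_list_prod, List.map_map]
  congr 1
  refine List.map_congr_left fun j _ => ?_
  simp only [Function.comp_apply, colProj, colSum, map_smul, map_add, map_one, map_sum,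
    map_matrix_apply]

/-- Only `w` has to preserve the linear functions: it acts first, and `v` is then applied to
coordinate functions again. -/
lemma linPart_mul {v w : Matrix (I → ℤˣ) (I → ℤˣ) A}
    (hw : ∀ x y, ∑ i, w (flip x i) y = ∑ i, w x (flip y i)) :
    linPart (v * w) = linPart v * linPart w := by
  have h1 : ∀ j x, rowSum (v * w) j x = ∑ k, rowSum v k x * linPart w k j := fun j x => by
    have h2 : rowSum (v * w) j x = ∑ z, v x z * rowSum w j z := by
      simp only [rowSum, Matrix.mul_apply, Finset.smul_sum, Finset.mul_sum, mul_smul_comm]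
      exact Finset.sum_comm
    rw [h2]
    simp only [rowSum_eq_colSum hw, colSum]
    simp only [rowSum, Finset.mul_sum, Finset.sum_mul,
      mul_smul_comm, smul_mul_assoc]
    exact Finset.sum_comm
  ext i j
  rw [linPart_eq_sum_rowSum, Matrix.mul_apply]
  simp only [h1, linPart_eq_sum_rowSum v, smul_mul_assoc, Finset.sum_mul]
  rw [← Finset.smul_sum]
  congr 1
  simp only [Finset.smul_sum]
  exact Finset.sum_comm

lemma linPart_one : linPart (1 : Matrix (I → ℤˣ) (I → ℤˣ) ℂ) = 1 := by
  ext i j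
  rw [linPart_apply]
  simp only [Matrix.one_apply, Finset.sum_ite_eq, Finset.mem_univ, if_true,
    smul_eq_mul, mul_one, sum_sgn_mul_sgn, mul_ite, mul_zero]
  rw [inv_mul_cancel₀ two_pow_ne_zero]

/-- This carries the antipode of the cube matrix to that of its linear part. -/
lemma linPart_opMatrix (v : Matrix (I → ℤˣ) (I → ℤˣ) A) (i j : I) :
    linPart (opMatrix v) i j = MulOpposite.op (linPart v j i) := by
  have h1 := linPart_transpose v
  have h2 : linPart v j i = linPart v.transpose i j := by rw [h1]; rfl
  rw [h2]
  simp only [linPart_apply, opMatrix_apply, MulOpposite.op_smul, Finset.op_sum,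
    Matrix.transpose_apply]

/-- The morphism between opposite algebras. -/
def opHom (f : A →⋆ₐ[ℂ] B) : Aᵐᵒᵖ →⋆ₐ[ℂ] Bᵐᵒᵖ where
  __ := AlgHom.op (f : A →ₐ[ℂ] B)
  map_star' a := congrArg MulOpposite.op (map_star f a.unop)

lemma opHom_apply (f : A →⋆ₐ[ℂ] B) (a : Aᵐᵒᵖ) : opHom f a = MulOpposite.op (f a.unop) := rfl

variable (n : ℕ)

/-- The linear part of the fundamental matrix of `A(Q_n)` is skew orthogonal. -/
lemma isSkewOrth_linPart_u : IsSkewOrth (linPart (QSym.u (hypercube n))) :=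
  (QSym.isGraphMagic_u (hypercube n)).toIsMagic.isSkewOrth_linPart
    (QSym.isGraphMagic_u (hypercube n)).sum_flip

/-- The isomorphism between `C(O_n^{-1})` and `A(Q_n)`. -/
def hypercubeIso : COneg (Fin n) ≃⋆ₐ[ℂ] QSym (hypercube n) :=
  StarAlgEquiv.ofStarAlgHom (COneg.lift _ (isSkewOrth_linPart_u n))
    (QSym.lift _ (COneg.isSkewOrth_u (Fin n)).isGraphMagic_cubeMatrix)
    (COneg.hom_ext fun i j => by
      rw [StarAlgHom.comp_apply, COneg.lift_u, map_linPart, map_QSym_u,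
        (COneg.isSkewOrth_u (Fin n)).linPart_cubeMatrix]
      rfl)
    (QSym.hom_ext fun x y => by
      have h := QSym.isGraphMagic_u (hypercube n)
      rw [StarAlgHom.comp_apply, QSym.lift_u, map_cubeMatrix, map_COneg_u,
        h.toIsMagic.cubeMatrix_linPart h.sum_flip]
      rfl)

lemma hypercubeIso_u (i j : Fin n) :
    hypercubeIso n (COneg.u (Fin n) i j) = linPart (QSym.u (hypercube n)) i j :=
  COneg.lift_u _ _ i j

lemma isHopfIso_hypercubeIso :
    IsHopfIso (COneg.hopf (Fin n)) (QSym.hopf (hypercube n)) (hypercubeIso n) where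
  comul a := by
    refine DFunLike.congr_fun
      (f := (QSym.hopf (hypercube n)).comul.comp (hypercubeIso n : _ →⋆ₐ[ℂ] _))
      (g := (CTensor.map (hypercubeIso n : _ →⋆ₐ[ℂ] _) (hypercubeIso n : _ →⋆ₐ[ℂ] _)).comp
        (COneg.hopf (Fin n)).comul) (COneg.hom_ext fun i j => ?_) a
    have h := QSym.isGraphMagic_u (hypercube n)
    have h1 : (QSym.hopf (hypercube n)).comul (hypercubeIso n (COneg.u (Fin n) i j)) =
        ∑ k, ctmul (linPart (QSym.u (hypercube n)) i k) (linPart (QSym.u (hypercube n)) k j) := by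
      rw [hypercubeIso_u, map_linPart]
      -- On the generators, the comultiplication of the linear part is the linear part of a product
      -- of two matrices, which factors by `linPart_mul`.
      have h2 : (QSym.u (hypercube n)).map (QSym.hopf (hypercube n)).comul =
          comulMatrix (QSym.u (hypercube n)) := map_QSym_u _ h.comul
      rw [h2, comulMatrix_eq_mul, linPart_mul (h.map _).sum_flip, Matrix.mul_apply]
      refine Finset.sum_congr rfl fun k _ => ?_
      rw [← map_linPart, ← map_linPart, leftHom_apply, rightHom_apply, ctmul_mul_ctmul, mul_one,
        one_mul]
    refine h1.trans ?_
    rw [StarAlgHom.comp_apply, (COneg.hopf (Fin n)).comul_apply, map_sum]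
    refine Finset.sum_congr rfl fun k _ => ?_
    rw [CTensor.map_ctmul]
    exact congrArg₂ ctmul (hypercubeIso_u n i k).symm (hypercubeIso_u n k j).symm
  counit a := by
    refine DFunLike.congr_fun
      (f := (QSym.hopf (hypercube n)).counit.comp (hypercubeIso n : _ →⋆ₐ[ℂ] _))
      (g := (COneg.hopf (Fin n)).counit) (COneg.hom_ext fun i j => ?_) a
    change (QSym.hopf (hypercube n)).counit (hypercubeIso n (COneg.u (Fin n) i j)) = _
    have h2 : (QSym.u (hypercube n)).map (QSym.hopf (hypercube n)).counit = 1 :=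
      map_QSym_u _ (isGraphMagic_one (hypercube n))
    rw [hypercubeIso_u, map_linPart, h2, linPart_one, (COneg.hopf (Fin n)).counit_apply,
      Matrix.one_apply]
  antipode a := by
    refine DFunLike.congr_fun
      (f := (QSym.hopf (hypercube n)).antipode.comp (hypercubeIso n : _ →⋆ₐ[ℂ] _))
      (g := (opHom (hypercubeIso n : _ →⋆ₐ[ℂ] _)).comp (COneg.hopf (Fin n)).antipode)
      (COneg.hom_ext fun i j => ?_) a
    change (QSym.hopf (hypercube n)).antipode (hypercubeIso n (COneg.u (Fin n) i j)) = _
    have h2 : (QSym.u (hypercube n)).map (QSym.hopf (hypercube n)).antipode =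
        opMatrix (QSym.u (hypercube n)) :=
      map_QSym_u _ (QSym.isGraphMagic_u (hypercube n)).op
    rw [hypercubeIso_u, map_linPart, h2, linPart_opMatrix, StarAlgHom.comp_apply,
      (COneg.hopf (Fin n)).antipode_apply, (COneg.isSkewOrth_u (Fin n)).real, opHom_apply,
      MulOpposite.unop_op]
    exact congrArg MulOpposite.op (hypercubeIso_u n j i).symm

end Iso

end QPerm

end

theorem mainTheorem7 (n : ℕ) :
    ∃ (H : QPerm.FGHopf (QPerm.COneg (Fin n)) (QPerm.COneg.u (Fin n)))
      (K : QPerm.FGHopf (QPerm.QSym (QPerm.hypercube n)) (QPerm.QSym.u (QPerm.hypercube n)))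
      (Φ : QPerm.COneg (Fin n) ≃⋆ₐ[ℂ] QPerm.QSym (QPerm.hypercube n)),
      QPerm.IsHopfIso H K Φ :=
  ⟨QPerm.COneg.hopf (Fin n), QPerm.QSym.hopf (QPerm.hypercube n), QPerm.hypercubeIso n,
    QPerm.isHopfIso_hypercubeIso n⟩
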